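/- **Conventions.** For a closed, shift-invariant set $X\subseteq\{a,b\}^{\mathbb Z}$ (a *binary shift*) let $\sigma(x)_n=x_{n+1}$. For a sequence $(\ell_n)_{n\ge1}$ of positive integers let $\mathbb Z_{(\ell_n)}=\prod_{n\ge 1}\mathbb Z/\ell_n\mathbb Z$ with coordinatewise addition with carry and the product topology, i.e. $\mathbb Z_{(\ell_n)}=\varprojlim_n\mathbb Z/\ell_1\cdots\ell_n\mathbb Z$; for $\ell_n=2$ this is the group $\mathbb Z_2$ of $2$-adic integers. The system $(\mathcal Z,+1)$ with $\mathcal Z=\mathbb Z_{(\ell_n)}$ is an *odometer*. A binary shift $(X,\sigma)$ is a *Toeplitz shift over* $\mathcal Z$ if there is a factor map $\pi:(X,\sigma)\to(\mathcal Z,+1)$ onto the minimal equicontinuous system $(\mathcal Z,+1)$ that is almost one-to-one, i.e. $\{x\in X:\pi^{-1}(\pi(x))=\{x\}\}$ is dense in $X$; then $\pi$ is the maximal equicontinuous factor map, i.e. every equicontinuous factor of $(X,\sigma)$ factors through $\pi$. A point $z\in\mathcal Z$ is *singular* if $\pi^{-1}(z)$ has more than one element, and a *discontinuity point* if $\pi^{-1}(z)$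 contains $x,y$ with $x_0\ne y_0$. The shift $X$ is *non-tame* if there are disjoint sets $V_0,V_1\subseteq\{a,b\}$ and a sequence $(t_n)_{n\in\mathbb N}$ of integers such that for every $\varphi\in\{0,1\}^{\mathbb N}$ there is $x\in X$ with $x_{t_n}\in V_{\varphi(n)}$ for all $n$; otherwise it is *tame*. A *Cantor set* is a nonempty, compact, totally disconnected set without isolated points in a metrizable space. **Theorem 1.3.** 1. There is a tame binary Toeplitz shift over the odometer $\mathbb Z_{(4^n)}$ whose set of discontinuity points is a Cantor set and whose maximal equicontinuous factor $\mathbb Z_{(4^n)}$ has uncountably many singular points. 2. There is a tame binary Toeplitz shift over $\mathbb Z_2$ whose set of singular points is a single orbit $z+\mathbb Z$ and such that the fibre $\pi^{-1}(w)$ is uncountable for every singular point $w$. 3. There is a non-tame binary Toeplitz shift over $\mathbb Z_2$ whose set of singular points is a single orbit $z+\mathbb Z$ and such that the fibre $\pi^{-1}(w)$ is uncountable for every singular point $w$. -/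

import Mathlib

open Set Topology
open SymbolicDynamics.FullShift (Subshift)

namespace ToeplitzShifts

/-! ### Invertible dynamical systems -/

section Systems

variable {X Z W : Type*} [TopologicalSpace X] [TopologicalSpace Z] [TopologicalSpace W]

/-- The full (two-sided) orbit of a point under a homeomorphism. -/
def fullOrbit (T : Z ≃ₜ Z) (z : Z) : Set Z := range fun n : ℤ => (T ^ n) z

/-- The system `(Z, T)` is minimal: every two-sided orbit is dense. -/
def IsMinimalSystem (T : Z ≃ₜ Z) : Prop := ∀ z : Z, Dense (fullOrbit T z)

/-- `π` is a factor map from the system `(X, T)` onto the system `(Z, S)`. -/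
structure IsFactorMap (T : X ≃ₜ X) (S : Z ≃ₜ Z) (π : X → Z) : Prop where
  continuous : Continuous π
  surjective : Function.Surjective π
  equivariant : ∀ x, π (T x) = S (π x)

/-- The family of all powers `Tⁿ`, `n ∈ ℤ`, is equicontinuous. -/
def IsEquicontinuousSystem {Y : Type*} [UniformSpace Y] (T : Y ≃ₜ Y) : Prop :=
  Equicontinuous fun (n : ℤ) (y : Y) => (T ^ n) y

/-- The map `π` is almost one-to-one: the points that are alone in their fibre are dense. -/
def IsAlmostOneToOne (π : X → Z) : Prop := Dense {x : X | π ⁻¹' {π x} = {x}}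

/-- `(Z, S)`, together with `π`, is the maximal equicontinuous factor of `(X, T)`: it is an
equicontinuous factor, and every equicontinuous factor of `(X, T)` on a compact metric space
factors through it. -/
structure IsMaximalEquicontinuousFactor {X Z : Type} [TopologicalSpace X] [UniformSpace Z]
    (T : X ≃ₜ X) (S : Z ≃ₜ Z) (π : X → Z) : Prop where
  isFactorMap : IsFactorMap T S π
  isEquicontinuous : IsEquicontinuousSystem S
  maximal : ∀ (W : Type) [MetricSpace W] [CompactSpace W] (R : W ≃ₜ W) (ρ : X → W),
    IsFactorMap T R ρ → IsEquicontinuousSystem R →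
      ∃ h : Z → W, IsFactorMap S R h ∧ h ∘ π = ρ

/-- `(X, T)` is an almost automorphic extension of `(Z, S)` through `π`: the system `(Z, S)` is
minimal, it is the maximal equicontinuous factor of `(X, T)`, and the factor map `π` is almost
one-to-one. -/
structure IsAlmostAutomorphicExtension {X Z : Type} [TopologicalSpace X] [UniformSpace Z]
    (T : X ≃ₜ X) (S : Z ≃ₜ Z) (π : X → Z) : Prop where
  isMinimal : IsMinimalSystem S
  isMaximalEquicontinuousFactor : IsMaximalEquicontinuousFactor T S π
  isAlmostOneToOne : IsAlmostOneToOne π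

/-- The singular points of the factor: those whose fibre has more than one element. -/
def singularPoints (π : X → Z) : Set Z := {z | (π ⁻¹' {z}).Nontrivial}

end Systems

/-! ### Cantor sets -/

/-- A subset `C` of a (metrizable) space is a Cantor set: it is nonempty, compact, totally
disconnected and perfect (closed without isolated points). -/
structure IsCantorSet {Z : Type*} [TopologicalSpace Z] (C : Set Z) : Prop where
  nonempty : C.Nonempty
  isCompact : IsCompact C
  isTotallyDisconnected : IsTotallyDisconnected C
  perfect : Perfect C

/-! ### Two-sided shifts -/

section Shifts

variable {K : Type*} [TopologicalSpace K]

/-- The left shift `(σ x)ₙ = xₙ₊₁` as a homeomorphism of a two-sided subshift. -/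
def shiftHomeo (X : Subshift K ℤ) : X.carrier ≃ₜ X.carrier where
  toFun x := ⟨fun n => x.1 (n + 1), by
    have h := X.mapsTo 1 x.2
    have e : SymbolicDynamics.FullShift.shift (1 : ℤ) x.1 = fun n => x.1 (n + 1) := by
      funext n
      simp [SymbolicDynamics.FullShift.shift, add_comm]
    rwa [e] at h⟩
  invFun x := ⟨fun n => x.1 (n - 1), by
    have h := X.mapsTo (-1) x.2
    have e : SymbolicDynamics.FullShift.shift (-1 : ℤ) x.1 = fun n => x.1 (n - 1) := by
      funext n
      simp [SymbolicDynamics.FullShift.shift, sub_eq_add_neg, add_comm]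
    rwa [e] at h⟩
  left_inv x := by
    ext n
    simp
  right_inv x := by
    ext n
    simp
  continuous_toFun := by
    refine Continuous.subtype_mk (continuous_pi fun n => ?_) _
    exact (continuous_apply _).comp continuous_subtype_val
  continuous_invFun := by
    refine Continuous.subtype_mk (continuous_pi fun n => ?_) _
    exact (continuous_apply _).comp continuous_subtype_val

/-- The shift `X` is non-tame: there are disjoint compact sets `V₀, V₁` of letters and times
`t₀, t₁, t₂, …` in `ℤ` such that every choice function `φ` is realised by some `x ∈ X`, that is,
`x` has at time `tₙ` a letter of `V₁` if `φ n` is true, and a letter of `V₀` otherwise. -/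
def IsNonTame (X : Subshift K ℤ) : Prop :=
  ∃ V₀ V₁ : Set K, IsCompact V₀ ∧ IsCompact V₁ ∧ Disjoint V₀ V₁ ∧
    ∃ t : ℕ → ℤ, ∀ φ : ℕ → Bool, ∃ x ∈ X.carrier, ∀ n, x (t n) ∈ if φ n then V₁ else V₀

/-- The shift `X` is tame. -/
def IsTame (X : Subshift K ℤ) : Prop := ¬ IsNonTame X

/-- The discontinuity points of a shift with factor map `π`: the points whose fibre contains two
sequences that disagree at the coordinate `0`. -/
def discontinuityPoints {Z : Type*} (X : Subshift K ℤ) (π : X.carrier → Z) : Set Z :=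
  {z | ∃ x y : X.carrier, π x = z ∧ π y = z ∧ x.1 0 ≠ y.1 0}

end Shifts

/-! ### Odometers -/

/-- The product `ℓ₁ ℓ₂ ⋯ ℓₙ`. -/
def modulus (ℓ : ℕ → ℕ) (n : ℕ) : ℕ := ∏ i ∈ Finset.Icc 1 n, ℓ i

theorem modulus_dvd_succ (ℓ : ℕ → ℕ) (n : ℕ) : modulus ℓ n ∣ modulus ℓ (n + 1) :=
  ⟨ℓ (n + 1), Finset.prod_Icc_succ_top (by omega) ℓ⟩

/-- The coherent sequences of residues modulo `ℓ₁ ⋯ ℓₙ`, as a subring of the product. -/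
def odometerSubring (ℓ : ℕ → ℕ) : Subring (∀ n : ℕ, ZMod (modulus ℓ n)) where
  carrier := {z | ∀ n, ZMod.castHom (modulus_dvd_succ ℓ n) (ZMod (modulus ℓ n)) (z (n + 1)) = z n}
  mul_mem' {a b} ha hb n := by
    rw [Pi.mul_apply, Pi.mul_apply, map_mul, ha n, hb n]
  one_mem' n := by
    rw [Pi.one_apply, Pi.one_apply, map_one]
  add_mem' {a b} ha hb n := by
    rw [Pi.add_apply, Pi.add_apply, map_add, ha n, hb n]
  zero_mem' n := by
    rw [Pi.zero_apply, Pi.zero_apply, map_zero]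
  neg_mem' {a} ha n := by
    rw [Pi.neg_apply, Pi.neg_apply, map_neg, ha n]

/-- The odometer group `ℤ_(ℓₙ)`, `n ≥ 1`: the inverse limit of the groups `ℤ / ℓ₁ ⋯ ℓₙ ℤ`, with the
topology of the product of discrete spaces. The digits `zᵢ ∈ {0, …, ℓᵢ - 1}` of an element
`… z₃ z₂ z₁` correspond to the residues `z₁ + z₂ ℓ₁ + ⋯ + zₙ ℓ₁ ⋯ ℓₙ₋₁` modulo `ℓ₁ ⋯ ℓₙ`, and
digitwise addition with carry to the addition of residues. -/
abbrev Odometer (ℓ : ℕ → ℕ) : Type := odometerSubring ℓ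

/-- The uniform structure of the topological group `ℤ_(ℓₙ)`. -/
instance (ℓ : ℕ → ℕ) : UniformSpace (Odometer ℓ) :=
  IsTopologicalAddGroup.rightUniformSpace (Odometer ℓ)

/-- The rotation `z ↦ z + 1`. -/
def addOne (Z : Type*) [TopologicalSpace Z] [Ring Z] [IsTopologicalRing Z] : Z ≃ₜ Z :=
  Homeomorph.addRight 1

end ToeplitzShifts

open ToeplitzShifts

/-! All three shifts come from one device. Let `D` be a closed set in the odometer and `f` a Boolean
function that is continuous off `D` and oscillates at each point of `D`; the shift consists of all
limits of itineraries of points whose orbit avoids `D`. If one sequence lies over `z` and `z'`,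
translation by `z' - z` preserves `D`, so aperiodicity of `D` gives a projection to the odometer
(`fst_unique`). Its discontinuity points form `D`, and its singular points are the integer
translates of `D`.

Over `ℤ_[2]`, `D` is `{0} ∪ {2 ^ k}` and `f (2 ^ k + u) = p (v u) k` for small `u ≠ 0`. As `u → 0`,
all points `2 ^ k` read the same row of `p`, so limits of rows appear in the fibre over `0` at the
times `2 ^ k`. Rows given by Dedekind cuts have uncountably many limits, but any two columns omit a
pair of values; rows given by finite sets approximate every sequence.

Over `ℤ_(4ⁿ)`, `D` is a Cantor set in which a nonzero translation that keeps two points in `D` up to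
the level where it becomes visible forces their addresses to agree up to that level.

Tameness: along independent times `t n → τ`, every choice function taking both values infinitely
often is realised only over `D - τ` (`add_mem_of_frequently`). In the dyadic case this set is
countable, so a diagonal choice leaves only the point `-τ`, where a pair of values is forbidden. In
the Cantor case, choosing values against the expected ones on infinitely many times pins down the
base point, which then determines a letter that was still free. -/

namespace ToeplitzShifts

open Filter

set_option linter.unusedSectionVars false

/-! ### Semicocycles over a monothetic group -/

section Semicocycle

variable {Z : Type} [CommRing Z] [UniformSpace Z]

/-- A Boolean function on `Z` that is continuous off the closed set `D`, takes both values near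
every point of `D`, and whose discontinuity set has trivial stabilizer. -/
structure IsSemicocycle (D : Set Z) (f : Z → Bool) : Prop where
  isClosed : IsClosed D
  continuousAt : ∀ z ∉ D, ContinuousAt f z
  oscillates : ∀ z ∈ D, ∀ b, z ∈ closure {u | u ∉ D ∧ f u = b}
  aperiodic : ∀ d, (∀ z ∈ D, z + d ∈ D) → (∀ z ∈ D, z - d ∈ D) → d = 0
  denseRange_intCast : DenseRange (Int.cast : ℤ → Z)

/-- The points whose integer orbit avoids `D`. -/
def genericPoints (D : Set Z) : Set Z := {w | ∀ n : ℤ, w + n ∉ D}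

/-- The sequence of values of `f` along the integer orbit of `w`. -/
def itinerary (f : Z → Bool) (w : Z) : ℤ → Bool := fun n => f (w + n)

/-- The closure of the graph of the itinerary map over the generic points. -/
def graphClosure (D : Set Z) (f : Z → Bool) : Set (Z × (ℤ → Bool)) :=
  closure ((fun w => (w, itinerary f w)) '' genericPoints D)

variable {D : Set Z} {f : Z → Bool}

theorem itinerary_mem_graphClosure {w : Z} (hw : w ∈ genericPoints D) :
    (w, itinerary f w) ∈ graphClosure D f :=
  subset_closure ⟨w, hw, rfl⟩

theorem add_intCast_mem_genericPoints {w : Z} (hw : w ∈ genericPoints D) (m : ℤ) :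
    w + m ∈ genericPoints D := fun n => by
  have := hw (m + n)
  rwa [Int.cast_add, ← add_assoc] at this

variable [IsTopologicalRing Z]

theorem shift_mem_graphClosure {z : Z} {x : ℤ → Bool} (h : (z, x) ∈ graphClosure D f) (m : ℤ) :
    (z + m, fun n => x (m + n)) ∈ graphClosure D f := by
  refine map_mem_closure (f := fun p : Z × (ℤ → Bool) => (p.1 + (m : Z), fun n => p.2 (m + n)))
    ?_ h ?_
  · fun_prop
  · rintro _ ⟨w, hw, rfl⟩
    refine ⟨w + m, add_intCast_mem_genericPoints hw m, ?_⟩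
    ext n
    · rfl
    · simp [itinerary, add_assoc]

namespace IsSemicocycle

/-- Off `D` the function is locally constant, so the letters of nearby itineraries stabilise and the
base point determines the limit. -/
theorem apply_eq (h : IsSemicocycle D f) {z : Z} {x : ℤ → Bool} (hx : (z, x) ∈ graphClosure D f)
    {n : ℤ} (hn : z + n ∉ D) : x n = f (z + n) := by
  have hfr := mem_closure_iff_frequently.1 hx
  have h1 : ∀ᶠ p : Z × (ℤ → Bool) in 𝓝 (z, x), p.2 n = x n := by
    have : ContinuousAt (fun p : Z × (ℤ → Bool) => p.2 n) (z, x) := by fun_prop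
    exact this.eventually ((isOpen_discrete {x n}).mem_nhds rfl)
  have h2 : ∀ᶠ p : Z × (ℤ → Bool) in 𝓝 (z, x), f (p.1 + n) = f (z + n) := by
    have : ContinuousAt (fun p : Z × (ℤ → Bool) => f (p.1 + n)) (z, x) :=
      ContinuousAt.comp (f := fun p : Z × (ℤ → Bool) => p.1 + (n : Z)) (h.continuousAt _ hn)
        (by fun_prop)
    exact this.eventually
      ((isOpen_discrete {f (z + n)}).mem_nhds rfl)
  obtain ⟨p, ⟨⟨w, hw, rfl⟩, hp1⟩, hp2⟩ := ((hfr.and_eventually h1).and_eventually h2).exists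
  exact hp1.symm.trans hp2

theorem eq_itinerary (h : IsSemicocycle D f) {z : Z} {x : ℤ → Bool}
    (hx : (z, x) ∈ graphClosure D f) (hz : z ∈ genericPoints D) : x = itinerary f z :=
  funext fun n => h.apply_eq hx (hz n)

theorem eventually_notMem (h : IsSemicocycle D f) {z : Z} (hz : z ∉ D) : ∀ᶠ u in 𝓝 z, u ∉ D :=
  h.isClosed.isOpen_compl.mem_nhds hz

theorem eventually_eq (h : IsSemicocycle D f) {z : Z} (hz : z ∉ D) :
    ∀ᶠ u in 𝓝 z, f u = f z :=
  (h.continuousAt z hz).eventually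
    ((isOpen_discrete {f z}).mem_nhds rfl)

theorem exists_add_intCast (h : IsSemicocycle D f) (z : Z) {v : Z} {p : Z → Prop}
    (hp : ∀ᶠ u in 𝓝 v, p u) : ∃ n : ℤ, p (z + n) := by
  obtain ⟨s, hs, hso, hvs⟩ := eventually_nhds_iff.1 hp
  obtain ⟨n, hn⟩ := h.denseRange_intCast.exists_mem_open
    (hso.preimage (continuous_const.add continuous_id : Continuous fun u => z + u))
    ⟨v - z, by simpa using hvs⟩
  exact ⟨n, hs _ hn⟩

/-- Suppose `v ∈ D` but `v + (z' - z) ∉ D`. Near the second point `f` is constant, while near `v` it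
takes the opposite value off `D`. An integer `n` bringing `z + n` there makes `z` and `z'` prescribe
different letters at time `n`. -/
theorem fst_unique (h : IsSemicocycle D f) {z z' : Z} {x : ℤ → Bool}
    (hz : (z, x) ∈ graphClosure D f) (hz' : (z', x) ∈ graphClosure D f) : z = z' := by
  have key : ∀ {z z' : Z}, (z, x) ∈ graphClosure D f → (z', x) ∈ graphClosure D f →
      ∀ v ∈ D, v + (z' - z) ∈ D := by
    intro z z' hz hz' v hv
    by_contra hd
    have hcont : Tendsto (fun u : Z => u + (z' - z)) (𝓝 v) (𝓝 (v + (z' - z))) :=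
      Continuous.tendsto (by fun_prop : Continuous fun u : Z => u + (z' - z)) v
    have h1 := hcont.eventually (h.eventually_notMem hd)
    have h2 := hcont.eventually (h.eventually_eq hd)
    obtain ⟨u, ⟨⟨huD, hu⟩, hu1⟩, hu2⟩ := (((mem_closure_iff_frequently.1
      (h.oscillates v hv (!f (v + (z' - z))))).and_eventually
        h1.eventually_nhds).and_eventually h2.eventually_nhds).exists
    obtain ⟨n, ⟨⟨hn1, hn2⟩, hn3⟩, hn4⟩ := h.exists_add_intCast z
      ((((h.eventually_notMem huD).and (h.eventually_eq huD)).and hu1).and hu2)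
    have e : z + (n : Z) + (z' - z) = z' + n := by ring
    rw [e] at hn3 hn4
    have a := h.apply_eq hz hn1
    have b := h.apply_eq hz' hn3
    rw [hn2, hu] at a
    rw [hn4, a] at b
    simp at b
  have := h.aperiodic (z' - z) (key hz hz') fun v hv => by
    have := key hz' hz v hv
    rwa [← neg_sub z' z, ← sub_eq_add_neg] at this
  exact (sub_eq_zero.1 this).symm

variable [CompactSpace Z] [T2Space Z]

/-- Baire category: oscillation makes the complement of `D` dense, and only countably many
translates are intersected. -/
theorem dense_genericPoints (h : IsSemicocycle D f) : Dense (genericPoints D) := by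
  have e : genericPoints D = ⋂ n : ℤ, (fun w : Z => w + n) ⁻¹' Dᶜ := by
    ext w
    simp [genericPoints]
  have hD : Dense Dᶜ := fun z => by
    by_cases hz : z ∈ D
    · exact closure_mono (fun u hu => hu.1) (h.oscillates z hz true)
    · exact subset_closure hz
  rw [e]
  refine dense_iInter_of_isOpen (fun n => ?_) fun n => ?_
  · exact h.isClosed.isOpen_compl.preimage (by fun_prop)
  · exact hD.preimage (Homeomorph.addRight (n : Z)).isOpenMap

/-- A family of letters at prescribed times is realised over `z` as soon as each finite subfamily
is realised off `D` at points arbitrarily close to `z`. -/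
theorem exists_mem_graphClosure (h : IsSemicocycle D f) {ι : Type*} (z : Z) (g : ι → ℤ)
    (α : ι → Bool)
    (hα : ∀ F : Finset ι, ∃ᶠ u : Z in 𝓝 z, ∀ i ∈ F, u + g i ∉ D ∧ f (u + g i) = α i) :
    ∃ x, (z, x) ∈ graphClosure D f ∧ ∀ i, x (g i) = α i := by
  have hK : IsCompact {x : ℤ → Bool | (z, x) ∈ graphClosure D f} := by
    refine (IsClosed.preimage (f := fun x : ℤ → Bool => (z, x)) (by fun_prop)
      isClosed_closure).isCompact
  have hC : ∀ i, IsClosed {x : ℤ → Bool | x (g i) = α i} := fun i =>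
    isClosed_eq (continuous_apply _) continuous_const
  obtain ⟨x, hx, hx'⟩ := hK.inter_iInter_nonempty _ hC fun F => by
    -- The given points `u` need not be generic, but finitely many letters off `D` are an open
    -- condition, so generic points near `u` realise them too. Compactness of the sequence space
    -- then yields a limit over `z`.
    set A : Set Z := {w | w ∈ genericPoints D ∧ ∀ i ∈ F, f (w + g i) = α i}
    have hzA : z ∈ closure A := by
      rw [mem_closure_iff]
      intro o ho hzo
      obtain ⟨u, hu, huo⟩ := ((hα F).and_eventually (ho.mem_nhds hzo)).exists
      have hev : ∀ᶠ w in 𝓝 u, ∀ i ∈ F, f (w + g i) = α i := by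
        rw [eventually_all_finset]
        intro i hi
        have := (Continuous.tendsto (by fun_prop : Continuous fun w : Z => w + (g i : Z)) u).eventually
          (h.eventually_eq (hu i hi).1)
        rwa [(hu i hi).2] at this
      obtain ⟨w, ⟨hw1, hw2⟩, hw3⟩ := ((mem_closure_iff_frequently.1
        (h.dense_genericPoints u)).and_eventually (ho.mem_nhds huo) |>.and_eventually hev).exists
      exact ⟨w, hw2, hw1, hw3⟩
    have hcl : IsClosed (Prod.fst '' closure ((fun w => (w, itinerary f w)) '' A)) :=
      (isClosed_closure.isCompact.image continuous_fst).isClosed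
    have hsub : A ⊆ Prod.fst '' closure ((fun w => (w, itinerary f w)) '' A) := fun w hw =>
      ⟨_, subset_closure ⟨w, hw, rfl⟩, rfl⟩
    obtain ⟨⟨z', x⟩, hx, rfl⟩ := hcl.closure_subset_iff.2 hsub hzA
    refine ⟨x, closure_mono (image_mono fun w hw => hw.1) hx, ?_⟩
    simp only [mem_iInter, mem_ofPred_eq]
    intro i hi
    have hcl' : IsClosed {p : Z × (ℤ → Bool) | p.2 (g i) = α i} :=
      isClosed_eq (by fun_prop) continuous_const
    refine hcl'.closure_subset_iff.2 ?_ hx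
    rintro _ ⟨w, hw, rfl⟩
    exact hw.2 i hi
  exact ⟨x, hx, by simpa using hx'⟩

theorem exists_mem_graphClosure_over (h : IsSemicocycle D f) (z : Z) :
    ∃ x, (z, x) ∈ graphClosure D f := by
  obtain ⟨x, hx, -⟩ := h.exists_mem_graphClosure z (Empty.elim : Empty → ℤ) Empty.elim
    fun F => (Eventually.of_forall fun u i => i.elim).frequently
  exact ⟨x, hx⟩

/-- The shift space of all limits of itineraries of generic points. -/
def toSubshift (_h : IsSemicocycle D f) : Subshift Bool ℤ where
  carrier := Prod.snd '' graphClosure D f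
  isClosed := ((isClosed_closure : IsClosed (graphClosure D f)).isCompact.image
    continuous_snd).isClosed
  mapsTo m := by
    rintro _ ⟨⟨z, x⟩, hx, rfl⟩
    exact ⟨_, shift_mem_graphClosure hx m, rfl⟩

theorem exists_fst (h : IsSemicocycle D f) (x : h.toSubshift.carrier) :
    ∃ z, (z, x.1) ∈ graphClosure D f := by
  obtain ⟨x, ⟨z, x⟩, hx, rfl⟩ := x
  exact ⟨z, hx⟩

/-- The projection of the shift space to the base group. -/
noncomputable def proj (h : IsSemicocycle D f) (x : h.toSubshift.carrier) : Z :=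
  (h.exists_fst x).choose

theorem proj_mem (h : IsSemicocycle D f) (x : h.toSubshift.carrier) :
    (h.proj x, x.1) ∈ graphClosure D f :=
  (h.exists_fst x).choose_spec

theorem proj_eq_iff (h : IsSemicocycle D f) (x : h.toSubshift.carrier) (z : Z) :
    h.proj x = z ↔ (z, x.1) ∈ graphClosure D f :=
  ⟨fun e => e ▸ h.proj_mem x, fun hz => h.fst_unique (h.proj_mem x) hz⟩

theorem mem_toSubshift (h : IsSemicocycle D f) {z : Z} {x : ℤ → Bool}
    (hx : (z, x) ∈ graphClosure D f) : x ∈ h.toSubshift.carrier := ⟨_, hx, rfl⟩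

/-- Continuity is the closed graph principle: preimages of closed sets are projections of compact
subsets of the graph closure. -/
theorem isFactorMap_proj (h : IsSemicocycle D f) :
    IsFactorMap (shiftHomeo h.toSubshift) (addOne Z) h.proj where
  continuous := by
    refine continuous_iff_isClosed.2 fun C hC => ?_
    have : h.proj ⁻¹' C = Subtype.val ⁻¹' (Prod.snd '' (graphClosure D f ∩ Prod.fst ⁻¹' C)) := by
      ext x
      constructor
      · intro hx
        exact ⟨(h.proj x, x.1), ⟨h.proj_mem x, hx⟩, rfl⟩
      · rintro ⟨⟨z, y⟩, ⟨hy, hz⟩, e : y = x.1⟩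
        subst e
        rw [mem_preimage, (h.proj_eq_iff x z).2 hy]
        exact hz
    rw [this]
    exact (((isClosed_closure : IsClosed (graphClosure D f)).inter
      (hC.preimage continuous_fst)).isCompact.image continuous_snd).isClosed.preimage
      continuous_subtype_val
  surjective z := by
    obtain ⟨x, hx⟩ := h.exists_mem_graphClosure_over z
    exact ⟨⟨x, h.mem_toSubshift hx⟩, (h.proj_eq_iff _ _).2 hx⟩
  equivariant x := by
    rw [proj_eq_iff]
    convert shift_mem_graphClosure (h.proj_mem x) 1 using 2
    · simp [addOne]
    · funext n
      simp [shiftHomeo, add_comm]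

theorem isAlmostOneToOne_proj (h : IsSemicocycle D f) : IsAlmostOneToOne h.proj := by
  intro x
  rw [closure_subtype]
  have : x.1 ∈ closure (itinerary f '' genericPoints D) := by
    refine map_mem_closure (f := Prod.snd) continuous_snd (h.proj_mem x) ?_
    rintro _ ⟨w, hw, rfl⟩
    exact ⟨w, hw, rfl⟩
  refine closure_mono ?_ this
  rintro _ ⟨w, hw, rfl⟩
  have hm := itinerary_mem_graphClosure (f := f) hw
  refine ⟨⟨_, h.mem_toSubshift hm⟩, ?_, rfl⟩
  have e : h.proj ⟨_, h.mem_toSubshift hm⟩ = w := (h.proj_eq_iff _ _).2 hm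
  rw [mem_ofPred_eq, e]
  ext y
  constructor
  · intro hy
    exact Subtype.ext (h.eq_itinerary ((h.proj_eq_iff _ _).1 hy) hw)
  · rintro rfl
    exact e

theorem discontinuityPoints_proj (h : IsSemicocycle D f) :
    discontinuityPoints h.toSubshift h.proj = D := by
  ext z
  constructor
  · rintro ⟨x, y, hx, hy, hxy⟩
    by_contra hz
    rw [proj_eq_iff] at hx hy
    have hz' : z + ((0 : ℤ) : Z) ∉ D := by simpa using hz
    exact hxy ((h.apply_eq hx hz').trans (h.apply_eq hy hz').symm)
  · intro hz
    have key : ∀ b, ∃ x, (z, x) ∈ graphClosure D f ∧ x 0 = b := fun b => by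
      obtain ⟨x, hx, hx'⟩ := h.exists_mem_graphClosure z (fun _ : Unit => 0) (fun _ => b)
        fun F => (mem_closure_iff_frequently.1 (h.oscillates z hz b)).mono
          fun u (hu : u ∉ D ∧ f u = b) i _ => by simpa using hu
      exact ⟨x, hx, hx' ()⟩
    obtain ⟨x, hx, hx0⟩ := key true
    obtain ⟨y, hy, hy0⟩ := key false
    exact ⟨⟨x, h.mem_toSubshift hx⟩, ⟨y, h.mem_toSubshift hy⟩, (h.proj_eq_iff _ _).2 hx,
      (h.proj_eq_iff _ _).2 hy, by simp [hx0, hy0]⟩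

theorem singularPoints_proj (h : IsSemicocycle D f) :
    singularPoints h.proj = {z : Z | ∃ n : ℤ, z + n ∈ D} := by
  ext z
  constructor
  · rintro ⟨x, hx, y, hy, hxy⟩
    by_contra hz
    have hz' : z ∈ genericPoints D := not_exists.1 hz
    refine hxy (Subtype.ext ?_)
    rw [h.eq_itinerary ((h.proj_eq_iff _ _).1 hx) hz', h.eq_itinerary ((h.proj_eq_iff _ _).1 hy) hz']
  · rintro ⟨n, hn⟩
    rw [← h.discontinuityPoints_proj] at hn
    obtain ⟨x, y, hx, hy, hxy⟩ := hn
    rw [proj_eq_iff] at hx hy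
    have hx' := shift_mem_graphClosure hx (-n)
    have hy' := shift_mem_graphClosure hy (-n)
    rw [Int.cast_neg, add_neg_cancel_right] at hx' hy'
    refine ⟨⟨_, h.mem_toSubshift hx'⟩, (h.proj_eq_iff _ _).2 hx', ⟨_, h.mem_toSubshift hy'⟩,
      (h.proj_eq_iff _ _).2 hy', fun e => hxy ?_⟩
    simpa using congrFun (congrArg Subtype.val e) n

end IsSemicocycle

end Semicocycle

/-! ### Maximal equicontinuous factors -/

section Factors

variable {X Z W : Type*} [TopologicalSpace X] [TopologicalSpace Z] [TopologicalSpace W]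

theorem IsFactorMap.zpow_apply {T : X ≃ₜ X} {S : Z ≃ₜ Z} {π : X → Z} (h : IsFactorMap T S π)
    (n : ℤ) (x : X) : π ((T ^ n) x) = (S ^ n) (π x) := by
  have hinv : ∀ x, π (T⁻¹ x) = S⁻¹ (π x) := fun x => by
    have : S (π (T⁻¹ x)) = π x := by
      rw [← h.equivariant]
      exact congrArg π (T.apply_symm_apply x)
    rw [← this]
    exact (S.symm_apply_apply _).symm
  induction n generalizing x with
  | zero => rfl
  | succ n ih =>
    rw [zpow_add_one, zpow_add_one]
    exact (ih (T x)).trans (congrArg _ (h.equivariant x))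
  | pred n ih =>
    rw [zpow_sub_one, zpow_sub_one]
    exact (ih (T⁻¹ x)).trans (congrArg _ (hinv x))

end Factors

section MaximalFactor

variable {X Z : Type} [TopologicalSpace X] [CompactSpace X] [UniformSpace Z] [T2Space Z]

/-- An equicontinuous factor cannot separate points of a fibre of an almost one-to-one factor map
onto a minimal system. -/
theorem IsFactorMap.eq_of_isEquicontinuousSystem {T : X ≃ₜ X} {S : Z ≃ₜ Z} {π : X → Z}
    (h : IsFactorMap T S π) (hS : IsMinimalSystem S) (hπ : IsAlmostOneToOne π) {W : Type}
    [MetricSpace W] {R : W ≃ₜ W} {ρ : X → W} (hρ : IsFactorMap T R ρ)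
    (hR : IsEquicontinuousSystem R) {x y : X} (hxy : π x = π y) : ρ x = ρ y := by
  obtain ⟨p, hp⟩ : {p : X | π ⁻¹' {π p} = {p}}.Nonempty :=
    haveI : Nonempty X := ⟨x⟩
    hπ.nonempty
  refine eq_of_forall_dist_le fun ε hε => ?_
  obtain ⟨δ, hδ, hδ'⟩ := Metric.equicontinuousAt_iff.1 (hR (ρ p)) (ε / 2) (half_pos hε)
  set U : Set X := ρ ⁻¹' Metric.ball (ρ p) δ
  have hU : IsOpen U := Metric.isOpen_ball.preimage hρ.continuous
  have hcl : IsClosed (π '' Uᶜ) :=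
    (hU.isClosed_compl.isCompact.image h.continuous).isClosed
  have hpU : π p ∉ π '' Uᶜ := by
    rintro ⟨q, hq, hqp⟩
    have : q ∈ π ⁻¹' {π p} := hqp
    rw [hp] at this
    rw [mem_singleton_iff.1 this] at hq
    exact hq (Metric.mem_ball_self hδ)
  -- The fibre of `p` is a single point of `U`, so fibres over points near `π p` lie wholly in `U`.
  -- Minimality moves the fibre of `x` into `U`, and equicontinuity keeps its image small on the way
  -- back.
  obtain ⟨_, hn, n, rfl⟩ := (hS (π x)).inter_open_nonempty _ hcl.isOpen_compl ⟨_, hpU⟩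
  have key : ∀ a, π a = π x → dist (ρ a) ((R ^ (-n)) (ρ p)) < ε / 2 := fun a ha => by
    have haU : (T ^ n) a ∈ U := by
      by_contra hc
      exact hn ⟨_, hc, by rw [h.zpow_apply, ha]⟩
    have := hδ' _ haU (-n)
    rw [dist_comm, hρ.zpow_apply] at this
    have e : (R ^ (-n)) ((R ^ n) (ρ a)) = ρ a := by
      rw [zpow_neg]
      exact (R ^ n).symm_apply_apply _
    rwa [e] at this
  have := dist_triangle_right (ρ x) (ρ y) ((R ^ (-n)) (ρ p))
  linarith [key x rfl, key y hxy.symm]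

theorem IsFactorMap.isMaximalEquicontinuousFactor {T : X ≃ₜ X} {S : Z ≃ₜ Z} {π : X → Z}
    (h : IsFactorMap T S π) (hS : IsMinimalSystem S) (hS' : IsEquicontinuousSystem S)
    (hπ : IsAlmostOneToOne π) : IsMaximalEquicontinuousFactor T S π where
  isFactorMap := h
  isEquicontinuous := hS'
  maximal W _ _ R ρ hρ hR := by
    have hq : IsQuotientMap π := h.continuous.isClosedMap.isQuotientMap h.continuous h.surjective
    have hfac : ∀ x, ρ (Function.surjInv h.surjective (π x)) = ρ x := fun x =>
      h.eq_of_isEquicontinuousSystem hS hπ hρ hR (Function.surjInv_eq h.surjective _)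
    have hcomp : (fun z => ρ (Function.surjInv h.surjective z)) ∘ π = ρ := funext hfac
    refine ⟨fun z => ρ (Function.surjInv h.surjective z), ⟨?_, ?_, ?_⟩, hcomp⟩
    · rw [hq.continuous_iff, hcomp]
      exact hρ.continuous
    · intro w
      obtain ⟨x, rfl⟩ := hρ.surjective w
      exact ⟨π x, hfac x⟩
    · intro z
      obtain ⟨x, rfl⟩ := h.surjective z
      rw [← h.equivariant, hfac, hfac, hρ.equivariant]

end MaximalFactor

/-! ### Rotations -/

section Rotation

variable {Z : Type} [CommRing Z] [UniformSpace Z] [IsTopologicalRing Z]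

theorem addOne_zpow_apply (n : ℤ) (z : Z) : (addOne Z ^ n) z = z + n := by
  induction n generalizing z with
  | zero => simp
  | succ n ih =>
    rw [zpow_add_one, Homeomorph.mul_apply, ih]
    simp only [addOne, Homeomorph.coe_addRight]
    push_cast
    ring
  | pred n ih =>
    have e : (addOne Z)⁻¹ z = z - 1 := by
      simp [addOne, Homeomorph.inv_def, Homeomorph.addRight_symm, sub_eq_add_neg]
    rw [zpow_sub_one, Homeomorph.mul_apply, ih, e]
    push_cast
    ring

theorem fullOrbit_addOne (z : Z) : fullOrbit (addOne Z) z = range fun n : ℤ => z + n := by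
  simp only [fullOrbit, addOne_zpow_apply]

theorem isMinimalSystem_addOne (hd : DenseRange (Int.cast : ℤ → Z)) :
    IsMinimalSystem (addOne Z) := fun z => by
  rw [fullOrbit_addOne]
  exact (Homeomorph.addLeft z).surjective.denseRange.comp hd (Homeomorph.addLeft z).continuous

theorem isEquicontinuousSystem_addOne [IsUniformAddGroup Z] :
    IsEquicontinuousSystem (addOne Z) := by
  refine UniformEquicontinuous.equicontinuous ?_
  intro V hV
  rw [uniformity_eq_comap_nhds_zero] at hV ⊢
  obtain ⟨U, hU, hUV⟩ := hV
  refine ⟨U, hU, fun p hp n => hUV ?_⟩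
  simpa [addOne_zpow_apply] using hp

end Rotation

namespace IsSemicocycle

variable {Z : Type} [CommRing Z] [UniformSpace Z] [IsTopologicalRing Z] [CompactSpace Z]
  [T2Space Z] {D : Set Z} {f : Z → Bool}

theorem isAlmostAutomorphicExtension [IsUniformAddGroup Z] (h : IsSemicocycle D f) :
    IsAlmostAutomorphicExtension (shiftHomeo h.toSubshift) (addOne Z) h.proj where
  isMinimal := isMinimalSystem_addOne h.denseRange_intCast
  isMaximalEquicontinuousFactor :=
    haveI : CompactSpace h.toSubshift.carrier :=
      isCompact_iff_compactSpace.1 h.toSubshift.isClosed.isCompact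
    h.isFactorMap_proj.isMaximalEquicontinuousFactor
      (isMinimalSystem_addOne h.denseRange_intCast) isEquicontinuousSystem_addOne
      h.isAlmostOneToOne_proj
  isAlmostOneToOne := h.isAlmostOneToOne_proj

/-- Fibres over points of one integer orbit have the same cardinality. -/
theorem countable_fibre_of_add_intCast (h : IsSemicocycle D f) {z : Z} (m : ℤ)
    (hz : (h.proj ⁻¹' {z + m}).Countable) : (h.proj ⁻¹' {z}).Countable := by
  have key : MapsTo (fun x : h.toSubshift.carrier =>
      (⟨fun n => x.1 (m + n), h.toSubshift.mapsTo m x.2⟩ : h.toSubshift.carrier))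
      (h.proj ⁻¹' {z}) (h.proj ⁻¹' {z + m}) := fun x hx =>
    (h.proj_eq_iff _ _).2 (shift_mem_graphClosure ((h.proj_eq_iff _ _).1 hx) m)
  refine key.countable_of_injOn (fun x _ y _ hxy => Subtype.ext (funext fun n => ?_)) hz
  simpa using congrFun (congrArg Subtype.val hxy) (-m + n)

/-- Along an independent sequence of times, every choice function that is not eventually constant
is realised over a translate of the discontinuity set. -/
theorem add_mem_of_frequently (h : IsSemicocycle D f) {x : h.toSubshift.carrier} {t : ℕ → ℤ}
    {τ : Z} (ht : Tendsto (fun n => (t n : Z)) atTop (𝓝 τ))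
    (hx : ∀ b, ∃ᶠ n in atTop, x.1 (t n) = b) : h.proj x + τ ∈ D := by
  by_contra hD
  have hlim : Tendsto (fun n => h.proj x + (t n : Z)) atTop (𝓝 (h.proj x + τ)) :=
    tendsto_const_nhds.add ht
  have h1 := hlim.eventually (h.eventually_notMem hD)
  have h2 := hlim.eventually (h.eventually_eq hD)
  obtain ⟨n, ⟨hn, hn1⟩, hn2⟩ :=
    (((hx (!f (h.proj x + τ))).and_eventually h1).and_eventually h2).exists
  rw [h.apply_eq (h.proj_mem x) hn1, hn2] at hn
  simp at hn

end IsSemicocycle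

/-! ### Independent times -/

/-- A non-tame binary shift has an independent sequence of times whose images in a given
sequentially compact topological ring converge. -/
theorem IsNonTame.exists_independent {Z : Type} [CommRing Z] [UniformSpace Z] [CompactSpace Z]
    [FirstCountableTopology Z] {X : Subshift Bool ℤ} (hX : IsNonTame X) :
    ∃ (t : ℕ → ℤ) (τ : Z), Function.Injective t ∧ Tendsto (fun n => (t n : Z)) atTop (𝓝 τ) ∧
      ∀ φ : ℕ → Bool, ∃ x : X.carrier, ∀ n, x.1 (t n) = φ n := by
  obtain ⟨V₀, V₁, -, -, hdisj, t, ht⟩ := hX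
  -- Both sets are nonempty, since the constant choices are realised; in a two-letter alphabet they
  -- are complementary singletons.
  obtain ⟨b, hb₁, hb₀⟩ : ∃ b, (∀ v ∈ V₁, v = b) ∧ ∀ v ∈ V₀, v = !b := by
    obtain ⟨x, -, hx⟩ := ht fun _ => true
    obtain ⟨y, -, hy⟩ := ht fun _ => false
    have hx0 : x (t 0) ∈ V₁ := by simpa using hx 0
    have hy0 : y (t 0) ∈ V₀ := by simpa using hy 0
    rw [disjoint_left] at hdisj
    refine ⟨x (t 0), fun v hv => ?_, fun v hv => ?_⟩
    · by_contra hne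
      have h1 : v ≠ y (t 0) := fun e => hdisj hy0 (e ▸ hv)
      have h2 : x (t 0) ≠ y (t 0) := fun e => hdisj hy0 (e ▸ hx0)
      revert hne h1 h2
      cases v <;> cases x (t 0) <;> cases y (t 0) <;> simp
    · have : v ≠ x (t 0) := fun e => hdisj hv (e ▸ hx0)
      revert this
      cases v <;> cases x (t 0) <;> simp
  have hind : ∀ φ : ℕ → Bool, ∃ x : X.carrier, ∀ n, x.1 (t n) = φ n := fun φ => by
    obtain ⟨x, hxX, hx⟩ := ht fun n => φ n == b
    refine ⟨⟨x, hxX⟩, fun n => ?_⟩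
    have hn := hx n
    cases hφ : (φ n == b)
    · rw [hφ] at hn
      have := hb₀ _ hn
      revert hφ this
      cases φ n <;> cases b <;> simp
    · rw [hφ] at hn
      rw [beq_iff_eq.1 hφ]
      exact hb₁ _ hn
  have hinj : Function.Injective t := fun m n hmn => by
    by_contra hne
    obtain ⟨x, hx⟩ := hind fun k => decide (k = m)
    have h1 := hx m
    have h2 := hx n
    rw [hmn, h2] at h1
    simp [Ne.symm hne] at h1
  obtain ⟨τ, s, hs, hτ⟩ := CompactSpace.tendsto_subseq fun n => (t n : Z)
  refine ⟨t ∘ s, τ, hinj.comp hs.injective, hτ, fun φ => ?_⟩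
  obtain ⟨x, hx⟩ := hind (Function.extend s φ fun _ => true)
  exact ⟨x, fun n => by rw [Function.comp_apply, hx, hs.injective.extend_apply]⟩

/-- A sequence with prescribed values at two places that differs infinitely often from each member
of a countable family. -/
theorem exists_frequently_ne (ψ : ℕ → ℕ → Bool) {m n : ℕ} (hmn : m ≠ n) (a b : Bool) :
    ∃ φ : ℕ → Bool, φ m = a ∧ φ n = b ∧ ∀ k, ∃ᶠ i in atTop, φ i ≠ ψ k i := by
  -- The indices `Nat.pair k _` are reserved for disagreeing with `ψ k`.
  refine ⟨fun i => if i = m then a else if i = n then b else !ψ i.unpair.1 i, by simp,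
    by simp [hmn.symm], fun k => frequently_atTop.2 fun N => ?_⟩
  refine ⟨Nat.pair k (N + m + n + 1), ?_, ?_⟩
  · have := Nat.right_le_pair k (N + m + n + 1)
    lia
  · have := Nat.right_le_pair k (N + m + n + 1)
    beta_reduce
    rw [if_neg (by lia : Nat.pair k _ ≠ m), if_neg (by lia : Nat.pair k _ ≠ n), Nat.unpair_pair]
    simp

/-! ### Binary Toeplitz shifts over the 2-adic integers with one singular orbit -/

section Dyadic

/-- The powers of two together with their limit. -/
def dyadicSet : Set ℤ_[2] := insert 0 (range fun k : ℕ => (2 : ℤ_[2]) ^ k)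

/-- The function on `ℤ_[2]` which near `2 ^ k` takes at `2 ^ k + u` the value `p (v u) k`, where `v`
is the 2-adic valuation. -/
noncomputable def dyadicFun (p : ℕ → ℕ → Bool) (z : ℤ_[2]) : Bool :=
  p (z - 2 ^ z.valuation).valuation z.valuation

theorem two_pow_ne_zero (k : ℕ) : (2 : ℤ_[2]) ^ k ≠ 0 := pow_ne_zero _ two_ne_zero

theorem valuation_two_pow (k : ℕ) : ((2 : ℤ_[2]) ^ k).valuation = k := by
  have := PadicInt.valuation_pow (p := 2) (2 : ℤ_[2]) k
  have h2 : (2 : ℤ_[2]).valuation = 1 := by simpa using PadicInt.valuation_p (p := 2)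
  rw [this, h2, mul_one]

theorem tendsto_two_pow : Tendsto (fun k : ℕ => (2 : ℤ_[2]) ^ k) atTop (𝓝 0) := by
  refine tendsto_pow_atTop_nhds_zero_of_norm_lt_one ?_
  have : ‖(2 : ℤ_[2])‖ = 2⁻¹ := by simpa using PadicInt.norm_p (p := 2)
  rw [this]
  norm_num

theorem valuation_eq_of_norm_eq {y z : ℤ_[2]} (hz : z ≠ 0) (h : ‖y‖ = ‖z‖) :
    y.valuation = z.valuation := by
  have hy : y ≠ 0 := by rwa [← norm_ne_zero_iff, h, norm_ne_zero_iff]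
  rw [PadicInt.norm_eq_zpow_neg_valuation hy, PadicInt.norm_eq_zpow_neg_valuation hz] at h
  have := zpow_right_injective₀ (by norm_num) (by norm_num) h
  simpa using this

theorem valuation_add_eq_left {y u : ℤ_[2]} (hy : y ≠ 0) (h : ‖u‖ < ‖y‖) :
    y + u ≠ 0 ∧ (y + u).valuation = y.valuation := by
  have e : ‖y + u‖ = ‖y‖ := by
    rw [PadicInt.norm_add_eq_max_of_ne h.ne', max_eq_left h.le]
  refine ⟨?_, valuation_eq_of_norm_eq hy e⟩
  rwa [← norm_ne_zero_iff, e, norm_ne_zero_iff]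

theorem eventually_norm_lt {y : ℤ_[2]} (hy : y ≠ 0) : ∀ᶠ u in 𝓝 (0 : ℤ_[2]), ‖u‖ < ‖y‖ := by
  filter_upwards [Metric.ball_mem_nhds (0 : ℤ_[2]) (norm_pos_iff.2 hy)] with u hu
  simpa using hu

theorem eventually_valuation_eq {z : ℤ_[2]} (hz : z ≠ 0) :
    ∀ᶠ u in 𝓝 z, u.valuation = z.valuation := by
  have : Tendsto (fun u => u - z) (𝓝 z) (𝓝 0) := by
    simpa only [sub_self] using (continuous_sub_right z).tendsto z
  filter_upwards [this.eventually (eventually_norm_lt hz)] with u hu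
  simpa using (valuation_add_eq_left hz hu).2

theorem isClosed_dyadicSet : IsClosed dyadicSet :=
  tendsto_two_pow.isCompact_insert_range.isClosed

/-- A perturbation smaller than `2 ^ k` does not change its valuation. The row `u.valuation` does
not depend on `k`, which couples the letters at different points of `D`. -/
theorem eventually_two_pow_add (p : ℕ → ℕ → Bool) (k : ℕ) : ∀ᶠ u in 𝓝 (0 : ℤ_[2]), u ≠ 0 →
    2 ^ k + u ∉ dyadicSet ∧ dyadicFun p (2 ^ k + u) = p u.valuation k := by
  filter_upwards [eventually_norm_lt (two_pow_ne_zero k)] with u hu hu0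
  obtain ⟨h1, h2⟩ := valuation_add_eq_left (two_pow_ne_zero k) hu
  rw [valuation_two_pow] at h2
  refine ⟨?_, ?_⟩
  · rintro (h | ⟨l, hl⟩)
    · exact h1 h
    · dsimp only at hl
      rw [← hl, valuation_two_pow] at h2
      subst h2
      simp [hu0] at hl
  · rw [dyadicFun, h2, add_sub_cancel_left]

/-! ### Patterns, limits of their rows, and the resulting fibres. -/

/-- The pattern `p` approximates each of the sequences in `L`, and these take both values at
each coordinate. -/
structure IsPatternFamily (p : ℕ → ℕ → Bool) (L : Set (ℕ → Bool)) : Prop where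
  exists_eq : ∀ α ∈ L, ∀ N, ∃ j ≥ N, ∀ k < N, p j k = α k
  exists_apply_eq : ∀ k b, ∃ α ∈ L, α k = b

variable {p : ℕ → ℕ → Bool} {L : Set (ℕ → Bool)}

namespace IsPatternFamily

theorem exists_tendsto (h : IsPatternFamily p L) {α : ℕ → Bool} (hα : α ∈ L) :
    ∃ u : ℕ → ℤ_[2], (∀ n, u n ≠ 0) ∧ Tendsto u atTop (𝓝 0) ∧
      ∀ k, ∀ᶠ n in atTop, 2 ^ k + u n ∉ dyadicSet ∧ dyadicFun p (2 ^ k + u n) = α k := by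
  choose j hj hj' using h.exists_eq α hα
  have htend : Tendsto (fun n => (2 : ℤ_[2]) ^ j n) atTop (𝓝 0) :=
    tendsto_two_pow.comp (tendsto_atTop_mono hj tendsto_id)
  refine ⟨fun n => 2 ^ j n, fun n => two_pow_ne_zero _, htend, fun k => ?_⟩
  filter_upwards [htend.eventually (eventually_two_pow_add p k), eventually_gt_atTop k]
    with n hn hkn
  have := hn (two_pow_ne_zero _)
  rwa [valuation_two_pow, hj' n k hkn] at this

theorem isSemicocycle (h : IsPatternFamily p L) : IsSemicocycle dyadicSet (dyadicFun p) where
  isClosed := isClosed_dyadicSet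
  continuousAt z hz := by
    have hz0 : z ≠ 0 := fun e => hz (Or.inl e)
    have hz1 : z - 2 ^ z.valuation ≠ 0 := fun e => hz (Or.inr ⟨_, (sub_eq_zero.1 e).symm⟩)
    have hcont : Tendsto (fun u : ℤ_[2] => u - 2 ^ z.valuation) (𝓝 z)
        (𝓝 (z - 2 ^ z.valuation)) :=
      (continuous_id.sub continuous_const :
        Continuous fun u : ℤ_[2] => u - 2 ^ z.valuation).tendsto z
    refine tendsto_nhds_of_eventually_eq ?_
    filter_upwards [eventually_valuation_eq hz0, hcont.eventually (eventually_valuation_eq hz1)]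
      with u h1 h2
    rw [dyadicFun, h1, h2, dyadicFun]
  oscillates z hz b := by
    have key : ∀ k : ℕ, (2 : ℤ_[2]) ^ k ∈ closure {u | u ∉ dyadicSet ∧ dyadicFun p u = b} := by
      intro k
      obtain ⟨α, hα, hb⟩ := h.exists_apply_eq k b
      obtain ⟨u, -, hu, hu'⟩ := h.exists_tendsto hα
      have hlim : Tendsto (fun n => 2 ^ k + u n) atTop (𝓝 ((2 : ℤ_[2]) ^ k)) := by
        simpa using tendsto_const_nhds.add hu
      refine mem_closure_of_tendsto hlim ?_
      simpa only [mem_ofPred_eq, hb] using hu' k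
    rcases hz with rfl | ⟨k, rfl⟩
    · exact isClosed_closure.mem_of_tendsto tendsto_two_pow (Eventually.of_forall key)
    · exact key k
  aperiodic d h1 h2 := by
    -- Since `0 ∈ D` and `D` consists of natural numbers, both `d` and `-d` are natural numbers.
    have hnat : ∀ z ∈ dyadicSet, ∃ m : ℕ, z = m := by
      rintro _ (rfl | ⟨k, rfl⟩)
      · exact ⟨0, by simp⟩
      · exact ⟨2 ^ k, by simp⟩
    obtain ⟨m, hm⟩ := hnat _ (h1 0 (Or.inl rfl))
    obtain ⟨n, hn⟩ := hnat _ (h2 0 (Or.inl rfl))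
    have : ((m + n : ℕ) : ℤ_[2]) = 0 := by
      rw [Nat.cast_add, ← hm, ← hn]
      ring
    rw [Nat.cast_eq_zero] at this
    have hm0 : m = 0 := by lia
    simpa [hm0] using hm
  denseRange_intCast := PadicInt.denseRange_intCast

theorem singularPoints_eq (h : IsPatternFamily p L) :
    singularPoints h.isSemicocycle.proj = fullOrbit (addOne ℤ_[2]) 0 := by
  rw [h.isSemicocycle.singularPoints_proj, fullOrbit_addOne]
  ext z
  constructor
  · rintro ⟨n, hn | ⟨k, hk⟩⟩
    · exact ⟨-n, by simp [eq_neg_of_add_eq_zero_left hn]⟩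
    · refine ⟨2 ^ k - n, ?_⟩
      push_cast
      rw [zero_add]
      exact sub_eq_of_eq_add hk
  · rintro ⟨n, rfl⟩
    exact ⟨-n, Or.inl (by simp)⟩

theorem exists_mem_fibre_zero (h : IsPatternFamily p L) {α : ℕ → Bool} (hα : α ∈ L) :
    ∃ x, h.isSemicocycle.proj x = 0 ∧ ∀ k : ℕ, x.1 (2 ^ k) = α k := by
  obtain ⟨u, -, hu, hu'⟩ := h.exists_tendsto hα
  obtain ⟨x, hx, hx'⟩ := h.isSemicocycle.exists_mem_graphClosure 0 (fun k : ℕ => (2 : ℤ) ^ k) α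
    fun F => hu.frequently (by
      refine Eventually.frequently ((eventually_all_finset F).2 fun k _ => ?_)
      filter_upwards [hu' k] with n hn
      simpa [add_comm] using hn)
  exact ⟨⟨x, h.isSemicocycle.mem_toSubshift hx⟩, (h.isSemicocycle.proj_eq_iff _ _).2 hx, hx'⟩

theorem not_countable_fibre (h : IsPatternFamily p L) (hL : ¬ L.Countable) {z : ℤ_[2]}
    (hz : z ∈ singularPoints h.isSemicocycle.proj) :
    ¬ (h.isSemicocycle.proj ⁻¹' {z}).Countable := by
  rw [h.singularPoints_eq, fullOrbit_addOne] at hz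
  obtain ⟨n, rfl⟩ := hz
  intro hc
  have h0 := h.isSemicocycle.countable_fibre_of_add_intCast n hc
  refine hL ((h0.image fun x => fun k : ℕ => x.1 (2 ^ k)).mono fun α hα => ?_)
  obtain ⟨x, hx, hx'⟩ := h.exists_mem_fibre_zero hα
  exact ⟨x, hx, funext hx'⟩

theorem isNonTame (h : IsPatternFamily p L) (hL : L = univ) :
    IsNonTame h.isSemicocycle.toSubshift := by
  refine ⟨{false}, {true}, isCompact_singleton, isCompact_singleton, by simp,
    fun k => 2 ^ k, fun φ => ?_⟩
  obtain ⟨x, -, hx⟩ := h.exists_mem_fibre_zero (α := φ) (hL ▸ mem_univ _)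
  refine ⟨x.1, x.2, fun n => ?_⟩
  rw [hx]
  cases φ n <;> simp

/-- A time at which `z` is translated off `D` has a forced letter. Otherwise the two times lead to
`2 ^ k` and `2 ^ l` with `k ≠ l`, and every nearby generic point reads both letters from one row of
`p`. -/
theorem exists_forbidden (h : IsPatternFamily p L)
    (hp : ∀ k l, k ≠ l → ∃ a b, ∀ j, ¬ (p j k = a ∧ p j l = b)) (z : ℤ_[2]) {m n : ℤ}
    (hmn : m ≠ n) (hm : z + m ≠ 0) (hn : z + n ≠ 0) :
    ∃ a b, ∀ x, (z, x) ∈ graphClosure dyadicSet (dyadicFun p) → ¬ (x m = a ∧ x n = b) := by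
  by_cases hmD : z + m ∈ dyadicSet
  swap
  · refine ⟨!dyadicFun p (z + m), true, fun x hx hab => ?_⟩
    rw [h.isSemicocycle.apply_eq hx hmD] at hab
    simp at hab
  by_cases hnD : z + n ∈ dyadicSet
  swap
  · refine ⟨true, !dyadicFun p (z + n), fun x hx hab => ?_⟩
    rw [h.isSemicocycle.apply_eq hx hnD] at hab
    simp at hab
  obtain ⟨k, hk⟩ := hmD.resolve_left hm
  obtain ⟨l, hl⟩ := hnD.resolve_left hn
  dsimp only at hk hl
  have hkl : k ≠ l := by
    rintro rfl
    exact hmn (Int.cast_injective (add_left_cancel (hk.symm.trans hl)))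
  obtain ⟨a, b, hab⟩ := hp k l hkl
  refine ⟨a, b, fun x hx ⟨hxa, hxb⟩ => ?_⟩
  have h1 : ∀ᶠ q : ℤ_[2] × (ℤ → Bool) in 𝓝 (z, x), q.2 m = a ∧ q.2 n = b := by
    have hc : Continuous fun q : ℤ_[2] × (ℤ → Bool) => (q.2 m, q.2 n) := by fun_prop
    filter_upwards [((isOpen_discrete {(a, b)}).preimage hc).mem_nhds
      (show (x m, x n) = (a, b) by rw [hxa, hxb])] with q hq
    exact Prod.ext_iff.1 hq
  have hlim : Tendsto (fun q : ℤ_[2] × (ℤ → Bool) => q.1 - z) (𝓝 (z, x)) (𝓝 0) := by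
    simpa using (by fun_prop : Continuous fun q : ℤ_[2] × (ℤ → Bool) => q.1 - z).tendsto (z, x)
  obtain ⟨q, ⟨⟨⟨w, hw, rfl⟩, hq⟩, hqk⟩, hql⟩ := (((mem_closure_iff_frequently.1 hx).and_eventually
    h1).and_eventually (hlim.eventually (eventually_two_pow_add p k))).and_eventually
      (hlim.eventually (eventually_two_pow_add p l)) |>.exists
  have hwz : w - z ≠ 0 := fun e => hw m (by rw [sub_eq_zero.1 e, ← hk]; exact Or.inr ⟨k, rfl⟩)
  have e1 : 2 ^ k + (w - z) = w + m := by rw [hk]; ring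
  have e2 : 2 ^ l + (w - z) = w + n := by rw [hl]; ring
  have e3 := (hqk hwz).2
  have e4 := (hql hwz).2
  simp only [e1] at e3
  simp only [e2] at e4
  exact hab _ ⟨e3.symm.trans hq.1, e4.symm.trans hq.2⟩

theorem isTame (h : IsPatternFamily p L)
    (hp : ∀ k l, k ≠ l → ∃ a b, ∀ j, ¬ (p j k = a ∧ p j l = b)) :
    IsTame h.isSemicocycle.toSubshift := by
  intro hX
  obtain ⟨t, τ, htinj, ht, hind⟩ := hX.exists_independent (Z := ℤ_[2])
  have hu : Tendsto (fun n => (t n : ℤ_[2]) - τ) atTop (𝓝 0) := by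
    simpa using ht.sub_const τ
  have hu0 : ∀ᶠ n in atTop, (t n : ℤ_[2]) - τ ≠ 0 := by
    have hinj : Function.Injective fun n => (t n : ℤ_[2]) - τ := fun m n hmn =>
      htinj (Int.cast_injective (sub_left_injective hmn))
    exact Nat.cofinite_eq_atTop ▸ hinj.tendsto_cofinite.eventually
      (eventually_cofinite_ne (0 : ℤ_[2]))
  obtain ⟨N, hN⟩ := eventually_atTop.1 hu0
  have hne : ∀ n ≥ N, -τ + (t n : ℤ_[2]) ≠ 0 := fun n hn => by
    rw [neg_add_eq_sub]
    exact hN n hn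
  obtain ⟨a, b, hab⟩ := h.exists_forbidden hp (-τ) (htinj.ne (Nat.succ_ne_self N).symm)
    (hne N le_rfl) (hne (N + 1) (Nat.le_succ N))
  -- The constants ensure that `φ` takes both values infinitely often; the sequence for `k + 2`
  -- gives the letters forced for large `n` if the base point is `2 ^ k - τ`. The values at `N` and
  -- `N + 1` are the pair forbidden over `-τ`.
  obtain ⟨φ, hφa, hφb, hφ⟩ := exists_frequently_ne (fun i n => match i with
    | 0 => true
    | 1 => false
    | k + 2 => dyadicFun p (2 ^ k + ((t n : ℤ_[2]) - τ))) (Nat.succ_ne_self N).symm a b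
  obtain ⟨x, hx⟩ := hind φ
  have hxD : h.isSemicocycle.proj x + τ ∈ dyadicSet := by
    refine h.isSemicocycle.add_mem_of_frequently ht fun c => ?_
    simp only [hx]
    cases c
    · simpa using hφ 0
    · simpa using hφ 1
  rcases hxD with h0 | ⟨k, hk⟩
  · have hz := (h.isSemicocycle.proj_eq_iff x _).1 (eq_neg_of_add_eq_zero_left h0)
    exact hab _ hz ⟨by rw [hx, hφa], by rw [hx, hφb]⟩
  · obtain ⟨n, ⟨hn1, hn2⟩, hn3⟩ := ((hφ (k + 2)).and_eventually
      (hu.eventually (eventually_two_pow_add p k))).and_eventually hu0 |>.exists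
    have e : h.isSemicocycle.proj x + t n = 2 ^ k + ((t n : ℤ_[2]) - τ) := by
      dsimp only at hk
      rw [hk]
      ring
    have := h.isSemicocycle.apply_eq (h.isSemicocycle.proj_mem x) (e ▸ (hn2 hn3).1)
    rw [e, hx] at this
    exact hn1 this

end IsPatternFamily

/-! ### Two patterns: Dedekind cuts and finite sets. -/

theorem exists_seq_frequently_eq (A : Type*) [Countable A] [Nonempty A] :
    ∃ e : ℕ → A, ∀ a N, ∃ j ≥ N, e j = a := by
  obtain ⟨g, hg⟩ := exists_surjective_nat A
  refine ⟨fun j => g j.unpair.1, fun a N => ?_⟩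
  obtain ⟨i, rfl⟩ := hg a
  exact ⟨Nat.pair i N, Nat.right_le_pair i N, by simp⟩

theorem not_countable_univ_bool_seq : ¬ (univ : Set (ℕ → Bool)).Countable := fun hc => by
  obtain ⟨g, hg⟩ := hc.exists_eq_range univ_nonempty
  obtain ⟨n, hn⟩ : (fun n => !g n n) ∈ range g := hg ▸ mem_univ _
  have := congrFun hn n
  simp at this

theorem exists_tame_dyadic_shift :
    ∃ (X : Subshift Bool ℤ) (π : X.carrier → ℤ_[2]),
      IsAlmostAutomorphicExtension (shiftHomeo X) (addOne ℤ_[2]) π ∧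
      IsTame X ∧
      (∃ z : ℤ_[2], singularPoints π = fullOrbit (addOne ℤ_[2]) z) ∧
      ∀ z ∈ singularPoints π, ¬ (π ⁻¹' {z}).Countable := by
  obtain ⟨e, he⟩ := exists_seq_frequently_eq ℚ
  set q : ℕ ≃ ℚ := (Denumerable.eqv ℚ).symm
  set cut : ℝ → ℕ → Bool := fun α k => decide ((q k : ℝ) < α)
  have hfam : IsPatternFamily (fun j k => decide (q k < e j)) (range cut) := by
    refine ⟨?_, fun k b => ?_⟩
    · rintro _ ⟨α, rfl⟩ N
      -- Strict lower cuts are left-continuous on finitely many rationals, so `α` is approximated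
      -- from below.
      have hev : ∀ᶠ r in 𝓝[<] α, ∀ k < N, ((q k : ℝ) < r ↔ (q k : ℝ) < α) := by
        refine (eventually_all_finite (finite_lt_nat N)).2 fun k _ => ?_
        by_cases hk : (q k : ℝ) < α
        · filter_upwards [Ioo_mem_nhdsLT hk] with r hr
          simp [hr.1, hk]
        · filter_upwards [self_mem_nhdsWithin] with r (hr : r < α)
          simp only [hk, iff_false, not_lt]
          exact hr.le.trans (not_lt.1 hk)
      obtain ⟨l, hl, hlr⟩ := (mem_nhdsLT_iff_exists_Ioo_subset' (sub_one_lt α)).1 hev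
      obtain ⟨r, hlr', hrα⟩ := exists_rat_btwn (mem_Iio.1 hl)
      obtain ⟨j, hj, rfl⟩ := he r N
      refine ⟨j, hj, fun k hk => ?_⟩
      have := hlr ⟨hlr', hrα⟩ k hk
      simp only [cut, ← this, Rat.cast_lt]
    · cases b
      · exact ⟨_, ⟨(q k : ℝ), rfl⟩, by simp [cut]⟩
      · exact ⟨_, ⟨(q k : ℝ) + 1, rfl⟩, by simp [cut]⟩
  have hcut : Function.Injective cut := by
    have key : ∀ α β, cut α = cut β → β ≤ α := fun α β hαβ => by
      by_contra! hlt
      obtain ⟨r, hr1, hr2⟩ := exists_rat_btwn hlt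
      have := congrFun hαβ (q.symm r)
      simp only [cut, Equiv.apply_symm_apply, hr2, decide_true, decide_eq_true_eq] at this
      exact lt_asymm this hr1
    exact fun α β hαβ => le_antisymm (key β α hαβ.symm) (key α β hαβ)
  have hunc : ¬ (range cut).Countable := fun hc => Cardinal.not_countable_real
    (MapsTo.countable_of_injOn (fun α _ => mem_range_self α) hcut.injOn hc)
  refine ⟨_, _, hfam.isSemicocycle.isAlmostAutomorphicExtension, hfam.isTame fun k l hkl => ?_,
    ⟨0, hfam.singularPoints_eq⟩, fun z hz => hfam.not_countable_fibre hunc hz⟩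
  -- A cut containing the larger rational contains the smaller one.
  rcases (q.injective.ne hkl).lt_or_gt with hlt | hlt
  · refine ⟨false, true, fun j => ?_⟩
    simp only [decide_eq_false_iff_not, decide_eq_true_eq, not_and, not_lt]
    exact fun hj => hj.trans hlt.le
  · refine ⟨true, false, fun j => ?_⟩
    simp only [decide_eq_false_iff_not, decide_eq_true_eq, not_and, not_lt, not_le]
    exact fun hj => hlt.trans hj

theorem exists_nonTame_dyadic_shift :
    ∃ (X : Subshift Bool ℤ) (π : X.carrier → ℤ_[2]),
      IsAlmostAutomorphicExtension (shiftHomeo X) (addOne ℤ_[2]) π ∧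
      IsNonTame X ∧
      (∃ z : ℤ_[2], singularPoints π = fullOrbit (addOne ℤ_[2]) z) ∧
      ∀ z ∈ singularPoints π, ¬ (π ⁻¹' {z}).Countable := by
  obtain ⟨e, he⟩ := exists_seq_frequently_eq (Finset ℕ)
  have hfam : IsPatternFamily (fun j k => decide (k ∈ e j)) univ := by
    refine ⟨fun α _ N => ?_, fun k b => ⟨fun _ => b, mem_univ _, rfl⟩⟩
    obtain ⟨j, hj, hej⟩ := he ((Finset.range N).filter fun k => α k = true) N
    exact ⟨j, hj, fun k hk => by simp [hej, hk]⟩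
  exact ⟨_, _, hfam.isSemicocycle.isAlmostAutomorphicExtension, hfam.isNonTame rfl,
    ⟨0, hfam.singularPoints_eq⟩, fun z hz => hfam.not_countable_fibre not_countable_univ_bool_seq hz⟩

end Dyadic

/-! ### Topology of odometers -/

section OdometerTopology

variable {ℓ : ℕ → ℕ}

theorem tendsto_odometer_iff {ι : Type*} {F : Filter ι} {u : ι → Odometer ℓ} {z : Odometer ℓ} :
    Tendsto u F (𝓝 z) ↔ ∀ n, ∀ᶠ i in F, (u i).1 n = z.1 n := by
  have h : Tendsto u F (𝓝 z) ↔ Tendsto (fun i => (u i).1) F (𝓝 z.1) :=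
    IsInducing.subtypeVal.tendsto_nhds_iff
  rw [h, tendsto_pi_nhds]
  simp only [nhds_discrete, tendsto_pure]

theorem isClosed_odometerSubring :
    IsClosed (odometerSubring ℓ : Set (∀ n : ℕ, ZMod (modulus ℓ n))) := by
  have : (odometerSubring ℓ : Set (∀ n : ℕ, ZMod (modulus ℓ n))) =
      ⋂ n, {z | ZMod.castHom (modulus_dvd_succ ℓ n) (ZMod (modulus ℓ n)) (z (n + 1)) = z n} := by
    ext z
    simp [odometerSubring]
  rw [this]
  refine isClosed_iInter fun n => isClosed_eq ?_ ?_
  · exact continuous_of_discreteTopology.comp (continuous_apply _)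
  · fun_prop

theorem compactSpace_odometer (hℓ : ∀ n, modulus ℓ n ≠ 0) :
    @CompactSpace (Odometer ℓ) UniformSpace.toTopologicalSpace := by
  have : ∀ n, NeZero (modulus ℓ n) := fun n => ⟨hℓ n⟩
  exact isCompact_iff_compactSpace.1 isClosed_odometerSubring.isCompact

theorem firstCountableTopology_odometer :
    @FirstCountableTopology (Odometer ℓ) UniformSpace.toTopologicalSpace :=
  IsInducing.subtypeVal.firstCountableTopology

theorem isUniformAddGroup_odometer : IsUniformAddGroup (Odometer ℓ) :=
  isUniformAddGroup_of_addCommGroup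

theorem Odometer.apply_eq_of_le {z w : Odometer ℓ} {k n : ℕ} (hkn : k ≤ n)
    (h : z.1 n = w.1 n) : z.1 k = w.1 k := by
  induction n, hkn using Nat.le_induction with
  | base => exact h
  | succ n _ ih => exact ih (by rw [← z.2 n, ← w.2 n, h])

@[simp]
theorem Odometer.intCast_apply (m : ℤ) (n : ℕ) : (m : Odometer ℓ).1 n = m := by
  simp

@[simp]
theorem Odometer.natCast_apply (m n : ℕ) : (m : Odometer ℓ).1 n = m := by
  simp

theorem denseRange_intCast_odometer : DenseRange (Int.cast : ℤ → Odometer ℓ) := fun z => by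
  choose m hm using fun n => ZMod.intCast_surjective (z.1 n)
  refine mem_closure_of_tendsto (f := fun n => (m n : Odometer ℓ)) (b := atTop)
    (tendsto_odometer_iff.2 fun k => ?_) (Eventually.of_forall fun n => mem_range_self _)
  filter_upwards [eventually_ge_atTop k] with n hn
  exact Odometer.apply_eq_of_le hn (by simp [hm])

theorem Odometer.exists_apply_ne_zero {u : Odometer ℓ} (hu : u ≠ 0) :
    ∃ m, u.1 m = 0 ∧ u.1 (m + 1) ≠ 0 := by
  by_contra! hc
  refine hu (Subtype.ext (funext fun n => ?_))
  induction n with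
  | zero =>
    have : Subsingleton (ZMod (modulus ℓ 0)) := ZMod.subsingleton_iff.2 (by simp [modulus])
    exact Subsingleton.elim _ _
  | succ n ih => exact hc n ih

end OdometerTopology

/-! ### A Cantor set in the odometer `ℤ_(4ⁿ)` with few coincidences between its translates -/

section CantorCode

/-- The moduli `4 ^ (1 + ⋯ + n)`. -/
abbrev quarticModulus (n : ℕ) : ℕ := modulus (fun n => 4 ^ n) n

/-- The odometer `ℤ_(4ⁿ)`. -/
abbrev QuarticOdometer : Type := Odometer (fun n => 4 ^ n)

theorem quarticModulus_succ (n : ℕ) :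
    quarticModulus (n + 1) = quarticModulus n * 4 ^ (n + 1) :=
  Finset.prod_Icc_succ_top (by lia) _

theorem lt_quarticModulus (n : ℕ) : n < quarticModulus n := by
  induction n with
  | zero => simp [modulus]
  | succ n ih =>
    rw [quarticModulus_succ, pow_succ]
    have := Nat.one_le_pow n 4 (by norm_num)
    nlinarith

theorem quarticModulus_pos (n : ℕ) : 0 < quarticModulus n := (Nat.zero_le n).trans_lt
  (lt_quarticModulus n)

/-- The digit at index `n` is only visible modulo `4 ^ (n + 1)`; code digits, and differences of
sibling digits, lie in a range short enough to be recovered from it. -/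
theorem eq_of_quarticModulus_mul_eq {n : ℕ} {x y : ℤ}
    (h : ((quarticModulus n * x : ℤ) : ZMod (quarticModulus (n + 1))) =
      ((quarticModulus n * y : ℤ) : ZMod (quarticModulus (n + 1))))
    (hxy : |x - y| < 4 ^ (n + 1)) : x = y := by
  rw [ZMod.intCast_eq_intCast_iff_dvd_sub, ← mul_sub, quarticModulus_succ] at h
  push_cast at h
  have hpos : (0 : ℤ) < quarticModulus n := by exact_mod_cast quarticModulus_pos n
  have h' := Int.eq_zero_of_abs_lt_dvd ((mul_dvd_mul_iff_left hpos.ne').1 h)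
    (by rwa [abs_sub_comm])
  lia

theorem intCast_quarticOdometer_injective :
    Function.Injective (Int.cast : ℤ → QuarticOdometer) := fun x y hxy => by
  have h := congrArg (fun z => z.1 (x - y).natAbs) hxy
  rw [Odometer.intCast_apply, Odometer.intCast_apply, ZMod.intCast_eq_intCast_iff_dvd_sub] at h
  have := Int.eq_zero_of_abs_lt_dvd h (by
    rw [abs_sub_comm, Int.abs_eq_natAbs]
    exact_mod_cast lt_quarticModulus (x - y).natAbs)
  lia

/-- The number whose binary digits are the first `n` terms of `α`. -/
def prefixNumber (α : ℕ → Bool) (n : ℕ) : ℕ := ∑ j ∈ Finset.range n, if α j then 2 ^ j else 0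

/-- The `n`-th digit of the point with address `α`: it determines the first `n + 1` terms of `α`,
and the difference between the digits of two siblings determines their parent. -/
def codeDigit (α : ℕ → Bool) (n : ℕ) : ℕ :=
  if α n then 2 ^ n + 2 * prefixNumber α n else prefixNumber α n

/-- The residue modulo `4 ^ (1 + ⋯ + n)` of the point with address `α`. -/
def codeResidue (α : ℕ → Bool) (n : ℕ) : ℕ :=
  ∑ j ∈ Finset.range n, quarticModulus j * codeDigit α j

theorem codeResidue_succ (α : ℕ → Bool) (n : ℕ) :
    codeResidue α (n + 1) = codeResidue α n + quarticModulus n * codeDigit α n :=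
  Finset.sum_range_succ _ _

/-- The point of the odometer with address `α`. -/
def codePoint (α : ℕ → Bool) : QuarticOdometer :=
  ⟨fun n => (codeResidue α n : ZMod (quarticModulus n)), fun n => by
    rw [map_natCast, codeResidue_succ]
    push_cast
    simp⟩

theorem codePoint_apply (α : ℕ → Bool) (n : ℕ) :
    (codePoint α).1 n = (codeResidue α n : ZMod (quarticModulus n)) := rfl

variable {α β : ℕ → Bool} {n : ℕ}

theorem prefixNumber_succ (α : ℕ → Bool) (n : ℕ) :
    prefixNumber α (n + 1) = prefixNumber α n + if α n then 2 ^ n else 0 :=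
  Finset.sum_range_succ _ _

theorem prefixNumber_lt (α : ℕ → Bool) (n : ℕ) : prefixNumber α n < 2 ^ n := by
  induction n with
  | zero => simp [prefixNumber]
  | succ n ih =>
    rw [prefixNumber_succ, pow_succ]
    split <;> lia

theorem prefixNumber_congr (h : ∀ j < n, α j = β j) : prefixNumber α n = prefixNumber β n :=
  Finset.sum_congr rfl fun j hj => by rw [h j (Finset.mem_range.1 hj)]

theorem eq_of_prefixNumber_eq (h : prefixNumber α n = prefixNumber β n) :
    ∀ j < n, α j = β j := by
  induction n with
  | zero => simp
  | succ n ih =>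
    have ha := prefixNumber_lt α n
    have hb := prefixNumber_lt β n
    rw [prefixNumber_succ, prefixNumber_succ] at h
    have hn : α n = β n := by
      cases hα : α n <;> cases hβ : β n <;> simp [hα, hβ] at h ⊢ <;> lia
    rw [hn, Nat.add_right_cancel_iff] at h
    intro j hj
    rcases Nat.lt_succ_iff_lt_or_eq.1 hj with hj | rfl
    · exact ih h j hj
    · exact hn

theorem codeDigit_add_two_le (α : ℕ → Bool) (n : ℕ) : codeDigit α n + 2 ≤ 3 * 2 ^ n := by
  have := prefixNumber_lt α n
  rw [codeDigit]
  split <;> lia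

theorem four_mul_two_pow_le (n : ℕ) : 4 * 2 ^ n ≤ 4 ^ (n + 1) := by
  rw [pow_succ', show 4 = 2 * 2 from rfl, mul_pow]
  have := Nat.one_le_two_pow (n := n)
  nlinarith

theorem codeDigit_congr (h : ∀ j < n + 1, α j = β j) : codeDigit α n = codeDigit β n := by
  rw [codeDigit, codeDigit, h n (Nat.lt_succ_self n),
    prefixNumber_congr fun j hj => h j (hj.trans (Nat.lt_succ_self n))]

/-- Whether the digit reaches `2 ^ n` reveals `α n`, and then the prefix can be solved for. -/
theorem eq_of_codeDigit_eq (h : codeDigit α n = codeDigit β n) : ∀ j < n + 1, α j = β j := by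
  have ha := prefixNumber_lt α n
  have hb := prefixNumber_lt β n
  rw [codeDigit, codeDigit] at h
  obtain ⟨hn, hp⟩ : α n = β n ∧ prefixNumber α n = prefixNumber β n := by
    cases hα : α n <;> cases hβ : β n <;> simp [hα, hβ] at h ⊢ <;> lia
  intro j hj
  rcases Nat.lt_succ_iff_lt_or_eq.1 hj with hj | rfl
  · exact eq_of_prefixNumber_eq hp j hj
  · exact hn

theorem codeResidue_congr (h : ∀ j < n, α j = β j) : codeResidue α n = codeResidue β n :=
  Finset.sum_congr rfl fun j hj => by
    rw [codeDigit_congr fun i hi => h i (by have := Finset.mem_range.1 hj; lia)]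

theorem codePoint_apply_congr (h : ∀ j < n, α j = β j) :
    (codePoint α).1 n = (codePoint β).1 n := by
  rw [codePoint_apply, codePoint_apply, codeResidue_congr h]

theorem eq_of_codePoint_apply_eq (h : (codePoint α).1 n = (codePoint β).1 n) :
    ∀ j < n, α j = β j := by
  induction n with
  | zero => simp
  | succ n ih =>
    have hr := codeResidue_congr (ih (Odometer.apply_eq_of_le (Nat.le_succ n) h))
    rw [codePoint_apply, codePoint_apply, codeResidue_succ, codeResidue_succ, hr, Nat.cast_add,
      Nat.cast_add, add_right_inj] at h
    refine eq_of_codeDigit_eq ?_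
    have h3 := four_mul_two_pow_le n
    have ha := codeDigit_add_two_le α n
    have hb := codeDigit_add_two_le β n
    have := eq_of_quarticModulus_mul_eq (x := codeDigit α n) (y := codeDigit β n)
      (by exact_mod_cast h) (by rw [abs_lt]; zify at *; constructor <;> linarith)
    exact_mod_cast this

theorem codePoint_injective : Function.Injective codePoint := fun α β h => funext fun n =>
  eq_of_codePoint_apply_eq (n := n + 1) (by rw [h]) n (Nat.lt_succ_self n)

theorem continuous_codePoint : Continuous codePoint := by
  refine continuous_iff_continuousAt.2 fun α => tendsto_odometer_iff.2 fun n => ?_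
  have : ∀ᶠ β : ℕ → Bool in 𝓝 α, ∀ j < n, β j = α j :=
    (eventually_all_finite (finite_lt_nat n)).2 fun j _ =>
      (continuous_apply j).continuousAt.eventually ((isOpen_discrete {α j}).mem_nhds rfl)
  filter_upwards [this] with β hβ
  exact codePoint_apply_congr hβ

/-- The set of all code points. -/
def codeSet : Set QuarticOdometer := range codePoint

theorem isCompact_codeSet : IsCompact codeSet := isCompact_range continuous_codePoint

theorem isCantorSet_codeSet : IsCantorSet codeSet where
  nonempty := range_nonempty _
  isCompact := isCompact_codeSet
  isTotallyDisconnected := isTotallyDisconnected_of_totallyDisconnectedSpace _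
  perfect := by
    refine ⟨isCompact_codeSet.isClosed, ?_⟩
    rintro _ ⟨α, rfl⟩
    rw [accPt_iff_frequently]
    have hlim : Tendsto (fun n => codePoint (Function.update α n (!α n))) atTop
        (𝓝 (codePoint α)) := by
      refine tendsto_odometer_iff.2 fun k => ?_
      filter_upwards [eventually_ge_atTop k] with n hn
      exact codePoint_apply_congr fun j hj => Function.update_of_ne (by lia) _ _
    refine hlim.frequently (Eventually.frequently (Eventually.of_forall fun n => ⟨?_, _, rfl⟩))
    intro h
    have := congrFun (codePoint_injective h) n
    simp at this

/-- A nonzero translation that keeps two code points in the code set to the precision where it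
becomes visible forces their addresses to agree to that precision. -/
theorem address_eq_of_add_eq {u : QuarticOdometer} {m : ℕ} (hu : u.1 m = 0)
    (hu' : u.1 (m + 1) ≠ 0) {α' β' : ℕ → Bool}
    (hα : (codePoint α').1 (m + 1) = (codePoint α + u).1 (m + 1))
    (hβ : (codePoint β').1 (m + 1) = (codePoint β + u).1 (m + 1)) :
    ∀ j < m + 1, α j = β j := by
  -- As `u` is invisible at level `m` and visible at `m + 1`, it moves an address to its sibling,
  -- and `u` is the difference of the two last digits.
  have key : ∀ {α α' : ℕ → Bool}, (codePoint α').1 (m + 1) = (codePoint α + u).1 (m + 1) →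
      α m ≠ α' m ∧ prefixNumber α' m = prefixNumber α m ∧
        u.1 (m + 1) = ((quarticModulus m * ((codeDigit α' m : ℤ) - codeDigit α m) : ℤ) :
          ZMod (quarticModulus (m + 1))) := by
    intro α α' h
    have hm : (codePoint α').1 m = (codePoint α).1 m := by
      rw [Odometer.apply_eq_of_le (Nat.le_succ m) h]
      change (codePoint α).1 m + u.1 m = _
      rw [hu, add_zero]
    have hpre := eq_of_codePoint_apply_eq hm
    have h' : (codePoint α').1 (m + 1) = (codePoint α).1 (m + 1) + u.1 (m + 1) := h
    refine ⟨fun e => hu' ?_, prefixNumber_congr hpre, ?_⟩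
    · have : (codePoint α').1 (m + 1) = (codePoint α).1 (m + 1) :=
        codePoint_apply_congr fun j hj => by
          rcases Nat.lt_succ_iff_lt_or_eq.1 hj with hj | rfl
          · exact hpre j hj
          · exact e.symm
      rw [this] at h'
      exact left_eq_add.1 h'
    · rw [← sub_eq_iff_eq_add'] at h'
      rw [← h', codePoint_apply, codePoint_apply, codeResidue_succ, codeResidue_succ,
        codeResidue_congr hpre]
      push_cast
      ring
  obtain ⟨hα1, hα2, hα3⟩ := key hα
  obtain ⟨hβ1, hβ2, hβ3⟩ := key hβ
  have hpα := prefixNumber_lt α m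
  have hpβ := prefixNumber_lt β m
  have hpow := four_mul_two_pow_le m
  -- The sign of the difference reveals `α m` and its size reveals the prefix. Its absolute value is
  -- below `2 * 2 ^ m`, so two such differences are less than `4 ^ (m + 1)` apart.
  have hd : ∀ {α α' : ℕ → Bool}, α m ≠ α' m → prefixNumber α' m = prefixNumber α m →
      (codeDigit α' m : ℤ) - codeDigit α m =
        if α m then -(2 ^ m + prefixNumber α m : ℤ) else 2 ^ m + prefixNumber α m := by
    intro α α' h1 h2
    rw [codeDigit, codeDigit, h2]
    cases h : α m <;> cases h' : α' m <;> simp [h, h'] at h1 ⊢ <;> ring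
  rw [hα3, hd hα1 hα2, hd hβ1 hβ2] at hβ3
  zify at hpα hpβ hpow
  have hfin := eq_of_quarticModulus_mul_eq hβ3
    (by rw [abs_lt]; split <;> split <;> constructor <;> linarith)
  obtain ⟨hm, hp⟩ : α m = β m ∧ prefixNumber α m = prefixNumber β m := by
    cases h : α m <;> cases h' : β m <;> simp [h, h'] at hfin ⊢ <;> lia
  intro j hj
  rcases Nat.lt_succ_iff_lt_or_eq.1 hj with hj | rfl
  · exact eq_of_prefixNumber_eq hp j hj
  · exact hm

/-! ### Absence of carries, and integer orbits of code points. -/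

theorem codeResidue_lt (α : ℕ → Bool) (n : ℕ) : codeResidue α n < quarticModulus n := by
  induction n with
  | zero => simp [codeResidue, modulus]
  | succ n ih =>
    have h1 := codeDigit_add_two_le α n
    have h2 := four_mul_two_pow_le n
    have h3 : quarticModulus n * (codeDigit α n + 1) ≤ quarticModulus n * 4 ^ (n + 1) :=
      Nat.mul_le_mul_left _ (by lia)
    rw [codeResidue_succ, quarticModulus_succ]
    lia

theorem codeResidue_succ_add_lt (α : ℕ → Bool) (n : ℕ) :
    codeResidue α (n + 1) + quarticModulus n < quarticModulus (n + 1) := by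
  have h0 := codeResidue_lt α n
  have h1 := codeDigit_add_two_le α n
  have h2 := four_mul_two_pow_le n
  have h3 : quarticModulus n * (codeDigit α n + 2) ≤ quarticModulus n * 4 ^ (n + 1) :=
    Nat.mul_le_mul_left _ (by lia)
  rw [codeResidue_succ, quarticModulus_succ]
  lia

/-- The slack in the digits means that adding `k` causes no wrap-around at high levels, so the
residues there differ by exactly `k`. Hence all high digits agree, and each of them encodes a whole
prefix. -/
theorem eq_of_codePoint_eq_add_natCast {k : ℕ} (h : codePoint α = codePoint β + k) : α = β := by
  have hres : ∀ n ≥ k, codeResidue α (n + 1) = codeResidue β (n + 1) + k := fun n hn => by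
    have h' : (codePoint α).1 (n + 1) =
        (codePoint β).1 (n + 1) + (k : QuarticOdometer).1 (n + 1) :=
      congrArg (fun z => z.1 (n + 1)) h
    rw [codePoint_apply, codePoint_apply, Odometer.natCast_apply, ← Nat.cast_add,
      ZMod.natCast_eq_natCast_iff'] at h'
    rwa [Nat.mod_eq_of_lt (codeResidue_lt α _), Nat.mod_eq_of_lt] at h'
    have := codeResidue_succ_add_lt β n
    have := lt_quarticModulus n
    lia
  funext j
  have h1 := hres (k + j) (by lia)
  have h2 := hres (k + j + 1) (by lia)
  rw [codeResidue_succ α (k + j + 1), codeResidue_succ β (k + j + 1), h1, add_right_comm,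
    Nat.add_right_cancel_iff, Nat.add_left_cancel_iff] at h2
  exact eq_of_codeDigit_eq (Nat.eq_of_mul_eq_mul_left (quarticModulus_pos _) h2) j (by lia)

/-- Distinct code points lie in distinct integer orbits. -/
theorem eq_of_codePoint_eq_add_intCast {k : ℤ} (h : codePoint α = codePoint β + k) : α = β := by
  obtain ⟨k, rfl | rfl⟩ := k.eq_nat_or_neg
  · exact eq_of_codePoint_eq_add_natCast (by simpa using h)
  · refine (eq_of_codePoint_eq_add_natCast (k := k) ?_).symm
    rw [h]
    push_cast
    ring

/-! ### The alternating function on the odometer and tameness of its shift. -/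

/-- The first precision at which a point is distinguished from the code set. -/
noncomputable def codeLevel (v : QuarticOdometer) : ℕ :=
  sInf {n | ∀ α, (codePoint α).1 n ≠ v.1 n}

theorem exists_codePoint_ne {v : QuarticOdometer} (hv : v ∉ codeSet) :
    ∃ n, ∀ α, (codePoint α).1 n ≠ v.1 n := by
  by_contra! hc
  choose γ hγ using hc
  refine hv (isCompact_codeSet.isClosed.mem_of_tendsto (f := fun n => codePoint (γ n)) (b := atTop)
    (tendsto_odometer_iff.2 fun k => ?_) (Eventually.of_forall fun n => ⟨_, rfl⟩))
  filter_upwards [eventually_ge_atTop k] with n hn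
  exact Odometer.apply_eq_of_le hn (hγ n)

theorem codeLevel_congr {v w : QuarticOdometer} (hv : v ∉ codeSet)
    (h : w.1 (codeLevel v) = v.1 (codeLevel v)) : codeLevel w = codeLevel v := by
  have hmem : codeLevel v ∈ {n | ∀ α, (codePoint α).1 n ≠ v.1 n} :=
    Nat.sInf_mem (exists_codePoint_ne hv)
  refine le_antisymm (Nat.sInf_le fun α => h ▸ hmem α) ?_
  refine le_csInf ⟨codeLevel v, fun α => h ▸ hmem α⟩ fun n hn => ?_
  by_contra! hlt
  have := Nat.sInf_le (s := {n | ∀ α, (codePoint α).1 n ≠ v.1 n}) (m := n)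
    (fun α => Odometer.apply_eq_of_le hlt.le h ▸ hn α)
  exact hlt.not_ge this

theorem codeLevel_eq {v : QuarticOdometer} {m : ℕ}
    (h : ∀ α, (codePoint α).1 (m + 1) ≠ v.1 (m + 1)) (h' : (codePoint α).1 m = v.1 m) :
    codeLevel v = m + 1 := by
  refine le_antisymm (Nat.sInf_le h) (le_csInf ⟨_, h⟩ fun n hn => ?_)
  by_contra! hlt
  exact hn α (Odometer.apply_eq_of_le (Nat.lt_succ_iff.1 hlt) h')

theorem notMem_codeSet {v : QuarticOdometer} {m : ℕ}
    (h : ∀ α, (codePoint α).1 m ≠ v.1 m) : v ∉ codeSet := by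
  rintro ⟨α, rfl⟩
  exact h α rfl

/-- The function that alternates with the distance from the code set. -/
noncomputable def codeFun (v : QuarticOdometer) : Bool := decide (Even (codeLevel v))

/-- An integer that agrees with a code point exactly up to a given precision. -/
theorem exists_codeLevel_eq (α : ℕ → Bool) (m : ℕ) :
    ∃ v : QuarticOdometer, v.1 m = (codePoint α).1 m ∧ v ∉ codeSet ∧
      codeLevel v = m + 1 := by
  -- Larger than every code digit at index `m`, yet smaller than `4 ^ (m + 1)`.
  set T : ℕ := 3 * 2 ^ m with hT
  have hv : (((codeResidue α m + quarticModulus m * T : ℕ) : QuarticOdometer)).1 m =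
      (codePoint α).1 m := by
    rw [Odometer.natCast_apply, codePoint_apply]
    push_cast
    simp
  have hne : ∀ γ, (codePoint γ).1 (m + 1) ≠
      ((codeResidue α m + quarticModulus m * T : ℕ) : QuarticOdometer).1 (m + 1) := by
    intro γ hγ
    have hpre := eq_of_codePoint_apply_eq
      ((Odometer.apply_eq_of_le (Nat.le_succ m) hγ).trans hv)
    rw [Odometer.natCast_apply, codePoint_apply, codeResidue_succ, codeResidue_congr hpre,
      Nat.cast_add, Nat.cast_add, add_right_inj] at hγ
    have h1 := codeDigit_add_two_le γ m
    have h2 := four_mul_two_pow_le m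
    have h3 := Nat.one_le_two_pow (n := m)
    have := eq_of_quarticModulus_mul_eq (x := codeDigit γ m) (y := T)
      (by exact_mod_cast hγ) (by rw [abs_lt]; zify at *; constructor <;> linarith)
    lia
  exact ⟨_, hv, notMem_codeSet hne, codeLevel_eq hne hv.symm⟩

theorem isSemicocycle_codeFun : IsSemicocycle codeSet codeFun where
  isClosed := isCompact_codeSet.isClosed
  continuousAt z hz := by
    refine tendsto_nhds_of_eventually_eq ?_
    filter_upwards [tendsto_odometer_iff.1 (tendsto_id (x := 𝓝 z)) (codeLevel z)]
      with u (hu : u.1 _ = z.1 _)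
    rw [codeFun, codeLevel_congr hz hu, codeFun]
  oscillates := by
    rintro _ ⟨α, rfl⟩ b
    -- The level is one more than the precision, so odd precisions give the value `true`.
    choose v hv hvD hvl using fun n => exists_codeLevel_eq α (2 * n + if b then 1 else 0)
    refine mem_closure_of_tendsto (f := v) (b := atTop) (tendsto_odometer_iff.2 fun k => ?_)
      (Eventually.of_forall fun n => ⟨hvD n, ?_⟩)
    · filter_upwards [eventually_ge_atTop k] with n hn
      exact Odometer.apply_eq_of_le (by lia) (hv n)
    · rw [codeFun, hvl]
      cases b <;> simp [parity_simps]
  aperiodic d h1 _ := by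
    by_contra hd
    obtain ⟨m, hm, hm'⟩ := Odometer.exists_apply_ne_zero hd
    obtain ⟨β, hβ⟩ := h1 _ ⟨fun _ => true, rfl⟩
    obtain ⟨γ, hγ⟩ := h1 _ ⟨fun _ => false, rfl⟩
    have := address_eq_of_add_eq hm hm' (congrArg (fun z => z.1 (m + 1)) hβ)
      (congrArg (fun z => z.1 (m + 1)) hγ) 0 (Nat.succ_pos m)
    simp at this
  denseRange_intCast := denseRange_intCast_odometer

theorem compactSpace_quarticOdometer :
    @CompactSpace QuarticOdometer UniformSpace.toTopologicalSpace :=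
  compactSpace_odometer fun n => (quarticModulus_pos n).ne'

attribute [local instance] compactSpace_quarticOdometer firstCountableTopology_odometer
  isUniformAddGroup_odometer

/-- If `codePoint α + u n` leaves the code set as soon as `u n` is visible, the letter there depends
only on `n`. Demanding the opposite letter for all even `n` forces returns to the code set at
unbounded precision, which determine `α` and hence the base point. -/
theorem isTame_codeFun : IsTame isSemicocycle_codeFun.toSubshift := by
  set h := isSemicocycle_codeFun
  intro hX
  obtain ⟨t, τ, htinj, ht, hind⟩ := hX.exists_independent (Z := QuarticOdometer)
  obtain ⟨N, hN⟩ : ∃ N, ∀ n ≥ N, (t n : QuarticOdometer) - τ ≠ 0 := by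
    have hinj : Function.Injective fun n => (t n : QuarticOdometer) - τ :=
      fun m n hmn => htinj (intCast_quarticOdometer_injective (sub_left_injective hmn))
    exact eventually_atTop.1 (Nat.cofinite_eq_atTop ▸ hinj.tendsto_cofinite.eventually
      (eventually_cofinite_ne (0 : QuarticOdometer)))
  choose m hm hm' using fun n => Odometer.exists_apply_ne_zero (hN (N + n) (Nat.le_add_right N n))
  set u : ℕ → QuarticOdometer := fun n => (t (N + n) : QuarticOdometer) - τ
  have hu : Tendsto u atTop (𝓝 0) := by
    have : Tendsto (fun n => N + n) atTop atTop := tendsto_atTop_mono (Nat.le_add_left · N) tendsto_id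
    simpa using (ht.comp this).sub_const τ
  have hmtop : Tendsto m atTop atTop := by
    refine tendsto_atTop.2 fun k => ?_
    filter_upwards [tendsto_odometer_iff.1 hu k] with n hn
    by_contra! hlt
    exact hm' n (Odometer.apply_eq_of_le (w := 0) hlt hn)
  -- away from a cylinder of addresses, the letter at time `t (N + n)` is determined by `n`
  have hdefault : ∀ (x : h.toSubshift.carrier) (α : ℕ → Bool) (n : ℕ),
      h.proj x + τ = codePoint α → x.1 (t (N + n)) = (!decide (Even (m n + 1))) →
      ∃ α', (codePoint α').1 (m n + 1) = (codePoint α + u n).1 (m n + 1) := by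
    intro x α n hx hxn
    by_contra! hc
    have e : h.proj x + t (N + n) = codePoint α + u n := by
      rw [← hx]
      simp only [u]
      ring
    have hlev : codeLevel (codePoint α + u n) = m n + 1 :=
      codeLevel_eq (α := α) hc (show _ = (codePoint α).1 (m n) + (u n).1 (m n) by
        rw [hm, add_zero])
    rw [h.apply_eq (h.proj_mem x) (by rw [e]; exact notMem_codeSet hc), e, codeFun, hlev] at hxn
    simp at hxn
  -- Even indices contradict the default letter; odd indices alternate, so that both letters occur
  -- infinitely often. The odd indices below `4` remain free to change.
  set φ : ℕ → Bool := fun n => if Even n then !decide (Even (m n + 1)) else decide (n % 4 = 1)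
  have hφ : ∀ ψ : ℕ → Bool, (∀ n, Even n → ψ n = φ n) → (∀ n ≥ 4, ψ n = φ n) →
      ∃ x : h.toSubshift.carrier, (∀ n, x.1 (t (N + n)) = ψ n) ∧
        ∃ α, h.proj x + τ = codePoint α ∧ ∀ n, Even n →
          ∃ α', (codePoint α').1 (m n + 1) = (codePoint α + u n).1 (m n + 1) := by
    intro ψ hψ hψ4
    obtain ⟨x, hx⟩ := hind fun n => ψ (n - N)
    have hxψ : ∀ n, x.1 (t (N + n)) = ψ n := fun n => by simp [hx]
    have hfreq : ∀ b, ∃ᶠ n in atTop, x.1 (t n) = b := fun b => by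
      refine frequently_atTop.2 fun k => ⟨N + (4 * (k + 1) + if b then 1 else 3), by lia, ?_⟩
      rw [hxψ, hψ4 _ (by lia)]
      cases b
      · have h1 : ¬ Even (4 * (k + 1) + 3) := by rw [Nat.even_iff]; lia
        simp [φ, h1]
      · have h1 : ¬ Even (4 * (k + 1) + 1) := by rw [Nat.even_iff]; lia
        have h2 : (4 * (k + 1) + 1) % 4 = 1 := by lia
        simp [φ, h1, h2]
    obtain ⟨α, hα⟩ := h.add_mem_of_frequently ht hfreq
    refine ⟨x, hxψ, α, hα.symm, fun n hn => hdefault x α n hα.symm ?_⟩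
    rw [hxψ, hψ n hn]
    simp only [φ, hn, if_true]
  obtain ⟨x, hx, α, hxα, hα⟩ := hφ φ (fun _ _ => rfl) fun _ _ => rfl
  -- The orbit of `h.proj x` meets the code set at most once, so one of the two free times has a
  -- letter forced by the base point. Changing `φ` there must change the base point, but the address
  -- is already determined.
  obtain ⟨q, hqo, hq4, hqD⟩ : ∃ q, ¬ Even q ∧ q < 4 ∧ h.proj x + t (N + q) ∉ codeSet := by
    by_contra! hc
    obtain ⟨β, hβ⟩ := hc 1 (by decide) (by norm_num)
    obtain ⟨γ, hγ⟩ := hc 3 (by decide) (by norm_num)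
    have e : codePoint β = codePoint γ + ((t (N + 1) - t (N + 3) : ℤ) :
        QuarticOdometer) := by
      rw [hβ, hγ]
      push_cast
      ring
    have hβγ := eq_of_codePoint_eq_add_intCast e
    rw [hβγ, hγ] at hβ
    have := htinj (intCast_quarticOdometer_injective (add_left_cancel hβ))
    lia
  obtain ⟨y, hy, β, hyβ, hβ⟩ := hφ (Function.update φ q (!φ q))
    (fun n hn => Function.update_of_ne (by rintro rfl; exact hqo hn) _ _)
    (fun n hn => Function.update_of_ne (by lia) _ _)
  have hαβ : α = β := funext fun j => by
    obtain ⟨k, hk⟩ := eventually_atTop.1 (hmtop.eventually_ge_atTop j)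
    obtain ⟨α', hα'⟩ := hα (2 * k) (even_two_mul k)
    obtain ⟨β', hβ'⟩ := hβ (2 * k) (even_two_mul k)
    exact address_eq_of_add_eq (hm _) (hm' _) hα' hβ' j
      (Nat.lt_succ_iff.2 (hk (2 * k) (by lia)))
  have hxy : h.proj x = h.proj y := add_right_cancel (hxα.trans (hαβ ▸ hyβ.symm))
  have h1 := h.apply_eq (h.proj_mem x) hqD
  have h2 := h.apply_eq (h.proj_mem y) (hxy ▸ hqD)
  rw [← hxy, ← h1, hx, hy] at h2
  simp at h2

theorem exists_tame_quarticOdometer_shift :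
    ∃ (X : Subshift Bool ℤ) (π : X.carrier → QuarticOdometer),
      IsAlmostAutomorphicExtension (shiftHomeo X) (addOne QuarticOdometer) π ∧
      IsTame X ∧
      IsCantorSet (discontinuityPoints X π) ∧
      ¬ (singularPoints π).Countable := by
  refine ⟨_, _, isSemicocycle_codeFun.isAlmostAutomorphicExtension, isTame_codeFun, ?_, ?_⟩
  · rw [isSemicocycle_codeFun.discontinuityPoints_proj]
    exact isCantorSet_codeSet
  · rw [isSemicocycle_codeFun.singularPoints_proj]
    intro hc
    refine not_countable_univ_bool_seq
      (MapsTo.countable_of_injOn (f := codePoint) (fun α _ => ?_) codePoint_injective.injOn hc)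
    exact ⟨0, α, by simp⟩

end CantorCode

end ToeplitzShifts

theorem theorem1p3 :
    -- A tame binary Toeplitz shift over `ℤ_(4ⁿ)` whose discontinuity points form a Cantor set.
    (∃ (X : Subshift Bool ℤ) (π : X.carrier → Odometer (fun n => 4 ^ n)),
      IsAlmostAutomorphicExtension (shiftHomeo X) (addOne (Odometer (fun n => 4 ^ n))) π ∧
      IsTame X ∧
      IsCantorSet (discontinuityPoints X π) ∧
      ¬ (singularPoints π).Countable) ∧
    -- A tame binary Toeplitz shift over `ℤ_2` with one singular orbit and uncountable fibres there.
    (∃ (X : Subshift Bool ℤ) (π : X.carrier → ℤ_[2]),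
      IsAlmostAutomorphicExtension (shiftHomeo X) (addOne ℤ_[2]) π ∧
      IsTame X ∧
      (∃ z : ℤ_[2], singularPoints π = fullOrbit (addOne ℤ_[2]) z) ∧
      ∀ z ∈ singularPoints π, ¬ (π ⁻¹' {z}).Countable) ∧
    -- A non-tame binary Toeplitz shift over `ℤ_2` with these two properties.
    (∃ (X : Subshift Bool ℤ) (π : X.carrier → ℤ_[2]),
      IsAlmostAutomorphicExtension (shiftHomeo X) (addOne ℤ_[2]) π ∧
      IsNonTame X ∧
      (∃ z : ℤ_[2], singularPoints π = fullOrbit (addOne ℤ_[2]) z) ∧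
      ∀ z ∈ singularPoints π, ¬ (π ⁻¹' {z}).Countable) := 
  ⟨exists_tame_quarticOdometer_shift, exists_tame_dyadic_shift, exists_nonTame_dyadic_shift⟩
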